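/- Let $T$ be a first-order theory (not necessarily complete) with NIP, i.e. every formula $\varphi(x;y)$ has finite VC-dimension, uniformly in the models of $T$. Let $\mathcal S$ be a sort of $T^{eq}$, i.e. the quotient of a $\emptyset$-definable set of $n$-tuples by a $\emptyset$-definable equivalence relation. Formulas below are without parameters, and $x$ is a variable of sort $\mathcal S$. A Keisler measure on $\mathcal S$ over a model $M\models T$ is a finitely additive probability measure on the Boolean algebra of $M$-definable subsets of $\mathcal S(M)$. It is *generically stable* if for every formula $\varphi(x;y)$ and $\epsilon>0$ there are $k\ge 1$ and $a_1,\dots,a_k\in\mathcal S(M)$ such that for every $b\in M^{|y|}$ $$\Bigl|\mu(\varphi(x;b))-\tfrac1k\,|\{i: M\models\varphi(a_i;b)\}|\Bigr|\le\epsilon .$$ A complete type over $M$ concentrating on $\mathcal S$ is generically stable if it is so as a $\{0,1\}$-valued measure, and it is realized if it is the type of an element of $\mathcal S(M)$. Measures in an $n$-tuple $x$ of variables of the home sort are the case where $\mathcal S(M)=M^n$. Then the following are equivalent. 1. ($T$ uniformly cuts finite sets in $\mathcal S$.) For every $\epsilon>0$ there are a formula $\chi(x;y)$ and $K\in\mathbb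 N$ such that for every $M\models T$, every finite $A\subseteq\mathcal S(M)$ with $|A|\ge K$ and every $r\in[0,1]$, there is $b\in M^{|y|}$ with $\bigl|\,|\chi(A;b)|/|A|-r\,\bigr|\le\epsilon$. 2. ($T$ uniformly cuts generically stable measures on $\mathcal S$.) For every formula $\varphi(x;y)$ and $\epsilon>0$ there is a formula $\chi(x;z)$ such that for every $M\models T$, every generically stable measure $\mu$ on $\mathcal S$ over $M$ with $\mu(\{c\})=0$ for all $c\in\mathcal S(M)$, every $a\in M^{|y|}$ and every real $r$ with $0\le r\le\mu(\varphi(x;a))$, there is $b\in M^{|z|}$ with $|\mu(\varphi(x;a)\wedge\chi(x;b))-r|\le\epsilon$. 3. For every $M\models T$, every generically stable complete type over $M$ concentrating on $\mathcal S$ is realized in $M$. Moreover, if $T$ is distal, i.e. (for NIP $T$) every generically stable measure $\mu$ over a model $M$ of $T$, in any finite tuple of variables of the home sort, is smooth (it has a unique extension to a Keisler measure over $N$ for every elementary extension $N\succeq M$), then $T$ uniformly cuts finite sets in $\mathcal S$. -/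

import Mathlib

open FirstOrder

universe u v

namespace ModelTheoryNIP

variable {L : FirstOrder.Language.{u, v}}

/-- `T` is NIP: every partitioned formula `φ(x; y)` has finite VC-dimension, i.e. there is `d`
such that in no model of `T` a family of `d` tuples is shattered by `φ`. -/
def IsNIP (T : L.Theory) : Prop :=
  ∀ (k m : ℕ) (φ : L.Formula (Fin k ⊕ Fin m)), ∃ d : ℕ,
    ∀ (M : Type (max u v)) [L.Structure M] [Nonempty M] [M ⊨ T],
      ¬ ∃ (a : Fin d → Fin k → M) (b : Set (Fin d) → Fin m → M),
        ∀ (i : Fin d) (s : Set (Fin d)), φ.Realize (Sum.elim (a i) (b s)) ↔ i ∈ s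

/-- A sort of `T` (more precisely of `T^eq`): the quotient of a `∅`-definable set of `n`-tuples by
a `∅`-definable equivalence relation on it. -/
structure DefSort (T : L.Theory) where
  /-- the length of the tuples -/
  arity : ℕ
  /-- the formula defining the set of representatives -/
  dom : L.Formula (Fin arity)
  /-- the formula defining the equivalence relation -/
  rel : L.Formula (Fin arity ⊕ Fin arity)
  refl : ∀ (M : Type (max u v)) [L.Structure M] [Nonempty M] [M ⊨ T] (x : Fin arity → M),
    dom.Realize x → rel.Realize (Sum.elim x x)
  symm : ∀ (M : Type (max u v)) [L.Structure M] [Nonempty M] [M ⊨ T] (x y : Fin arity → M),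
    dom.Realize x → dom.Realize y → rel.Realize (Sum.elim x y) → rel.Realize (Sum.elim y x)
  trans : ∀ (M : Type (max u v)) [L.Structure M] [Nonempty M] [M ⊨ T] (x y z : Fin arity → M),
    dom.Realize x → dom.Realize y → dom.Realize z →
    rel.Realize (Sum.elim x y) → rel.Realize (Sum.elim y z) → rel.Realize (Sum.elim x z)

/-- The sort of `n`-tuples of elements of the home sort. -/
noncomputable def realSort (T : L.Theory) (n : ℕ) : DefSort T where
  arity := n
  dom := ⊤
  rel := Language.Formula.iInf fun i : Fin n =>
    Language.Term.equal (Language.var (Sum.inl i : Fin n ⊕ Fin n)) (Language.var (Sum.inr i : Fin n ⊕ Fin n))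
  refl := by
    intro M _ _ _ x _
    simp
  symm := by
    intro M _ _ _ x y _ _ h
    simp at h ⊢
    exact fun i => (h i).symm
  trans := by
    intro M _ _ _ x y z _ _ _ h h'
    simp at h h' ⊢
    exact fun i => (h i).trans (h' i)

namespace DefSort

variable {T : L.Theory} (S : DefSort T)
variable (M : Type (max u v)) [L.Structure M] [Nonempty M] [M ⊨ T]

/-- The tuples of `M` that represent an element of the sort. -/
def Rep : Type (max u v) := {x : Fin S.arity → M // S.dom.Realize x}

/-- The equivalence relation on representatives. -/
def setoid : Setoid (S.Rep M) where
  r x y := S.rel.Realize (Sum.elim x.1 y.1)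
  iseqv :=
    { refl := fun x => S.refl M x.1 x.2
      symm := fun {x y} h => S.symm M x.1 y.1 x.2 y.2 h
      trans := fun {x y z} h h' => S.trans M x.1 y.1 z.1 x.2 y.2 z.2 h h' }

/-- The elements of the sort `S` in the model `M`. -/
def Elem : Type (max u v) := Quotient (S.setoid M)

variable {M}

/-- The element of the sort with a given representative. -/
def toElem (x : S.Rep M) : S.Elem M := Quotient.mk (S.setoid M) x

/-- The subset `φ(S; b)` of `S(M)` defined by the formula `φ(x; y)` and the parameter `b`. The
formula is applied to representatives and read as `∃ x, [x] = s ∧ φ(x; b)`, so that no invariance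
has to be imposed on `φ`; up to equivalence these are all formulas in one variable of sort `S`. -/
def definedBy {m : ℕ} (φ : L.Formula (Fin S.arity ⊕ Fin m)) (b : Fin m → M) : Set (S.Elem M) :=
  {s | ∃ x : S.Rep M, S.toElem x = s ∧ φ.Realize (Sum.elim x.1 b)}

/-- `X ⊆ S(M)` is definable with parameters from `M`. -/
def IsDefinable (X : Set (S.Elem M)) : Prop :=
  (Set.univ : Set M).Definable L {x : Fin S.arity → M | ∃ h : S.dom.Realize x, S.toElem ⟨x, h⟩ ∈ X}

lemma IsDefinable.union {X Y : Set (S.Elem M)} (hX : S.IsDefinable X) (hY : S.IsDefinable Y) :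
    S.IsDefinable (X ∪ Y) := by
  unfold IsDefinable at *
  convert Set.Definable.union hX hY using 1
  ext x
  constructor
  · rintro ⟨h, h1 | h1⟩
    · exact Or.inl ⟨h, h1⟩
    · exact Or.inr ⟨h, h1⟩
  · rintro (⟨h, h1⟩ | ⟨h, h1⟩)
    · exact ⟨h, Or.inl h1⟩
    · exact ⟨h, Or.inr h1⟩

end DefSort

variable {T : L.Theory}

/-- A Keisler measure over the model `M` on the sort `S`: a finitely additive probability measure
on the Boolean algebra of `M`-definable subsets of `S(M)`, extended by `0` to all other sets. -/
structure KeislerMeasure (S : DefSort T) (M : Type (max u v)) [L.Structure M] [Nonempty M]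
    [M ⊨ T] where
  toFun : Set (S.Elem M) → ℝ
  not_definable : ∀ X, ¬ S.IsDefinable X → toFun X = 0
  nonneg : ∀ X, S.IsDefinable X → 0 ≤ toFun X
  univ : toFun Set.univ = 1
  union : ∀ X Y, S.IsDefinable X → S.IsDefinable Y → Disjoint X Y →
    toFun (X ∪ Y) = toFun X + toFun Y

/-- A complete type over the model `M` concentrating on the sort `S`: an ultrafilter of the
Boolean algebra of `M`-definable subsets of `S(M)`. -/
structure TypeOver (S : DefSort T) (M : Type (max u v)) [L.Structure M] [Nonempty M]
    [M ⊨ T] where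
  sets : Set (Set (S.Elem M))
  definable : ∀ X ∈ sets, S.IsDefinable X
  univ_mem : Set.univ ∈ sets
  inter_mem : ∀ X ∈ sets, ∀ Y ∈ sets, X ∩ Y ∈ sets
  superset_mem : ∀ X ∈ sets, ∀ Y, S.IsDefinable Y → X ⊆ Y → Y ∈ sets
  compl_mem_iff : ∀ X, S.IsDefinable X → (Xᶜ ∈ sets ↔ X ∉ sets)

section

variable {S : DefSort T} {M : Type (max u v)} [L.Structure M] [Nonempty M] [M ⊨ T]

/-- The frequency `Av(a₁, …, aₖ; X)` of a finite sequence in a set. -/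
noncomputable def avg {A : Type*} {k : ℕ} (a : Fin k → A) (X : Set A) : ℝ :=
  ({i : Fin k | a i ∈ X}.ncard : ℝ) / k

/-- A measure over `M` is generically stable if, for every formula, it is approximated by
averages over finite sequences of `M`, uniformly over the parameters from `M`. -/
def KeislerMeasure.IsGenericallyStable (μ : KeislerMeasure S M) : Prop :=
  ∀ (m : ℕ) (φ : L.Formula (Fin S.arity ⊕ Fin m)) (ε : ℝ), 0 < ε →
    ∃ (k : ℕ) (a : Fin k → S.Elem M), 0 < k ∧
      ∀ b : Fin m → M, |μ.toFun (S.definedBy φ b) - avg a (S.definedBy φ b)| ≤ ε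

/-- `ν`, over the elementary extension `N` of `M`, extends `μ`. -/
def KeislerMeasure.Extends {N : Type (max u v)} [L.Structure N] [Nonempty N] [N ⊨ T]
    (ν : KeislerMeasure S N) (f : M ↪ₑ[L] N) (μ : KeislerMeasure S M) : Prop :=
  ∀ (m : ℕ) (φ : L.Formula (Fin S.arity ⊕ Fin m)) (b : Fin m → M),
    ν.toFun (S.definedBy φ (f ∘ b)) = μ.toFun (S.definedBy φ b)

/-- A measure over `M` is smooth if it has a unique extension to every elementary extension. -/
def KeislerMeasure.IsSmooth (μ : KeislerMeasure S M) : Prop :=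
  ∀ (N : Type (max u v)) [L.Structure N] [Nonempty N] [N ⊨ T] (f : M ↪ₑ[L] N),
    ∃! ν : KeislerMeasure S N, ν.Extends f μ

open Classical in
/-- A complete type, seen as a `{0, 1}`-valued measure. -/
noncomputable def TypeOver.toMeasure (p : TypeOver S M) : KeislerMeasure S M where
  toFun X := if X ∈ p.sets then 1 else 0
  not_definable X hX := if_neg fun h => hX (p.definable X h)
  nonneg X _ := by split_ifs <;> norm_num
  univ := if_pos p.univ_mem
  union X Y hX hY hd := by
    have hXY := DefSort.IsDefinable.union S hX hY
    by_cases h1 : X ∈ p.sets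
    · have h2 : Y ∉ p.sets := by
        intro h2
        have h3 := p.inter_mem X h1 Y h2
        rw [Set.disjoint_iff_inter_eq_empty.1 hd] at h3
        exact (p.compl_mem_iff _ (p.definable _ h3)).1 (by simpa using p.univ_mem) h3
      have h3 : X ∪ Y ∈ p.sets := p.superset_mem X h1 _ hXY Set.subset_union_left
      simp [h1, h2, h3]
    · by_cases h2 : Y ∈ p.sets
      · have h3 : X ∪ Y ∈ p.sets := p.superset_mem Y h2 _ hXY Set.subset_union_right
        simp [h1, h2, h3]
      · have h3 : X ∪ Y ∉ p.sets := by
          rw [← p.compl_mem_iff _ hXY, Set.compl_union]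
          exact p.inter_mem _ ((p.compl_mem_iff X hX).2 h1) _ ((p.compl_mem_iff Y hY).2 h2)
        simp [h1, h2, h3]

/-- A complete type over `M` is generically stable if it is so as a measure. -/
def TypeOver.IsGenericallyStable (p : TypeOver S M) : Prop :=
  p.toMeasure.IsGenericallyStable

/-- A complete type over `M` is realized (in `M`). -/
def TypeOver.IsRealized (p : TypeOver S M) : Prop :=
  ∃ c : S.Elem M, ∀ X, S.IsDefinable X → (X ∈ p.sets ↔ c ∈ X)

end

/-- `T` uniformly cuts finite sets in `S`. -/
def UniformlyCutsFiniteSets (S : DefSort T) : Prop :=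
  ∀ ε : ℝ, 0 < ε → ∃ (m : ℕ) (χ : L.Formula (Fin S.arity ⊕ Fin m)) (K : ℕ),
    ∀ (M : Type (max u v)) [L.Structure M] [Nonempty M] [M ⊨ T] (A : Finset (S.Elem M)),
      K ≤ A.card → ∀ r : ℝ, 0 ≤ r → r ≤ 1 → ∃ b : Fin m → M,
        |(((A : Set (S.Elem M)) ∩ S.definedBy χ b).ncard : ℝ) / A.card - r| ≤ ε

/-- `T` uniformly cuts generically stable measures on `S`. -/
def UniformlyCutsGenericallyStableMeasures (S : DefSort T) : Prop :=
  ∀ (k : ℕ) (φ : L.Formula (Fin S.arity ⊕ Fin k)) (ε : ℝ), 0 < ε →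
    ∃ (m : ℕ) (χ : L.Formula (Fin S.arity ⊕ Fin m)),
      ∀ (M : Type (max u v)) [L.Structure M] [Nonempty M] [M ⊨ T] (μ : KeislerMeasure S M),
        μ.IsGenericallyStable → (∀ c : S.Elem M, μ.toFun {c} = 0) →
        ∀ (a : Fin k → M) (r : ℝ), 0 ≤ r → r ≤ μ.toFun (S.definedBy φ a) →
          ∃ b : Fin m → M, |μ.toFun (S.definedBy φ a ∩ S.definedBy χ b) - r| ≤ ε

/-- Every generically stable type (over a model of `T`) concentrating on `S` is realized. -/
def GenericallyStableTypesRealized (S : DefSort T) : Prop :=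
  ∀ (M : Type (max u v)) [L.Structure M] [Nonempty M] [M ⊨ T] (p : TypeOver S M),
    p.IsGenericallyStable → p.IsRealized

/-- A (NIP) theory is distal if all its generically stable measures, in any finite tuple of
variables of the home sort and over any model, are smooth. -/
def IsDistal (T : L.Theory) : Prop :=
  IsNIP T ∧ ∀ (n : ℕ) (M : Type (max u v)) [L.Structure M] [Nonempty M] [M ⊨ T]
    (μ : KeislerMeasure (realSort T n) M), μ.IsGenericallyStable → μ.IsSmooth

end ModelTheoryNIP

/-!
The implications form a cycle. Throughout, a *frequency measure* is the normalized counting measure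
of a finite sequence.

*Combinatorics.* By the Sauer–Shelah lemma a formula defines, in a NIP theory, families of sets of
polynomial growth (`IsNIP.exists_polyGrowth`). For such a family, integer weights can be halved with
small discrepancy: even weights are halved exactly and odd ones are rounded according to a random
choice of signs, which an exponential moment bound shows to be balanced on all members of the family
at once (`PolyGrowth.exists_half`). The relative errors of iterated halving add up to
a small error. Hence every frequency measure is close to one of bounded size
(`exists_bounded_approximation`), and every frequency measure with small relative multiplicities is
close to the counting measure of a large set without repetitions (`exists_finset_approximation`).

*From finite sets to measures.* An atomless generically stable measure is approximated by large
finite sets, and a formula that cuts finite sets cuts the part of such a set inside `φ(x; a)`.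

*From measures to types.* A type is a `{0, 1}`-valued measure, so it has no subset of measure about
`1 / 2`; if it is not realized, it is atomless.

*From types to finite sets.* An ultraproduct of generically stable measures is generically stable,
as the sizes of the approximating sequences are bounded (`IsNIP.ultraMeasure_isGenericallyStable`).
If finite sets are not uniformly cut, an ultraproduct `μ` of counting measures of growing finite
sets is atomless and omits an interval of values. Partial unions of sets of small measure cannot
jump over this interval, so some complete type `p` consists of sets of measure at least `ε`. If
`X ∈ p` has measure close to the infimum of `μ` on `p`, then `μ (X ∩ Y) / μ X` is close to `0` or
`1` according to whether `Y ∈ p`, uniformly in `Y`. So `p` is generically stable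
(`KeislerMeasure.IsGenericallyStable.of_atom`), and it is not realized.

*Distality.* Let `p` be a generically stable type on the sort `S` which is not realized. Lifting
approximating sequences to representatives and taking an ultraproduct gives a generically stable
measure `ν` on tuples over some model `N`, whose image `q` on `S` is `{0, 1}`-valued and atomless
(`IsNIP.exists_lift`). On finitely many definable sets, `ν` agrees with a measure supported by the
representatives of a single element of `S`: those atoms of the finite Boolean algebra that have
positive measure have an image in `S` of `q`-measure `1`, so these images have a common point. Thus
over an ultrapower of `N` there is an extension of `ν` whose image on `S` is a point mass, and also
one whose image is atomless. So `ν` is not smooth (`not_isSmooth_of_image_atomless`).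
-/

namespace ModelTheoryNIP

variable {L : FirstOrder.Language.{u, v}}

/-! ### Halving integer weights: finite approximations of bounded size -/

section Approximation

variable {X : Type*}

open Classical in
/-- The exponential moments of a random signed sum are at most those of a Gaussian variable. -/
lemma sum_exp_signed_sum_le (O B : Finset X) (hB : B ⊆ O) (l : ℝ) :
    ∑ P ∈ O.powerset, Real.exp (l * ∑ x ∈ B, (if x ∈ P then 1 else -1 : ℝ)) ≤
      2 ^ O.card * Real.exp (l ^ 2 * O.card / 2) := by
  have h1 : ∀ P ∈ O.powerset, Real.exp (l * ∑ x ∈ B, (if x ∈ P then 1 else -1 : ℝ)) =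
      (∏ x ∈ P, if x ∈ B then Real.exp l else 1) *
        ∏ x ∈ O \ P, if x ∈ B then Real.exp (-l) else 1 := by
    intro P hP
    rw [Finset.mem_powerset] at hP
    rw [Finset.mul_sum, Real.exp_sum]
    have h2 : ∏ x ∈ B, Real.exp (l * (if x ∈ P then 1 else -1 : ℝ)) =
        ∏ x ∈ O, if x ∈ B then Real.exp (l * (if x ∈ P then 1 else -1 : ℝ)) else 1 := by
      rw [← Finset.prod_filter, Finset.filter_mem_eq_inter, Finset.inter_eq_right.2 hB]
    rw [h2, ← Finset.prod_sdiff hP, mul_comm]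
    congr 1
    · refine Finset.prod_congr rfl fun x hx => ?_
      simp [hx]
    · refine Finset.prod_congr rfl fun x hx => ?_
      simp [(Finset.mem_sdiff.1 hx).2]
  rw [Finset.sum_congr rfl h1, ← Finset.prod_add]
  calc ∏ x ∈ O, ((if x ∈ B then Real.exp l else 1) + if x ∈ B then Real.exp (-l) else 1)
      ≤ ∏ x ∈ O, (2 * Real.exp (l ^ 2 / 2)) := by
        refine Finset.prod_le_prod (fun x _ => by split_ifs <;> positivity) fun x _ => ?_
        have h3 := Real.cosh_le_exp_half_sq l
        rw [Real.cosh_eq] at h3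
        have h4 : 1 ≤ Real.exp (l ^ 2 / 2) := Real.one_le_exp (by positivity)
        split_ifs <;> linarith
    _ = _ := by
        rw [Finset.prod_const, mul_pow, ← Real.exp_nat_mul]
        ring_nf

open Classical in
/-- The probabilistic discrepancy bound: a uniformly random choice of signs on `O` has positive
probability of being balanced on all members of `𝒜` at once. -/
lemma exists_balanced_subset (O : Finset X) (𝒜 : Finset (Finset X)) (h𝒜 : ∀ B ∈ 𝒜, B ⊆ O)
    (l : ℝ) :
    ∃ P ⊆ O, ∀ B ∈ 𝒜, l * |∑ x ∈ B, (if x ∈ P then 1 else -1 : ℝ)| ≤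
      Real.log (2 * 𝒜.card) + l ^ 2 * O.card / 2 := by
  set s : Finset X → Finset X → ℝ := fun P B => ∑ x ∈ B, (if x ∈ P then 1 else -1 : ℝ) with hs
  have h1 : ∑ P ∈ O.powerset, ∑ B ∈ 𝒜, (Real.exp (l * s P B) + Real.exp (-l * s P B)) ≤
      ∑ P ∈ O.powerset, (2 * 𝒜.card * Real.exp (l ^ 2 * O.card / 2)) := by
    rw [Finset.sum_comm]
    calc _ ≤ ∑ B ∈ 𝒜, (2 * (2 ^ O.card * Real.exp (l ^ 2 * O.card / 2))) := by
          refine Finset.sum_le_sum fun B hB => ?_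
          rw [Finset.sum_add_distrib, two_mul]
          refine add_le_add (sum_exp_signed_sum_le O B (h𝒜 B hB) l) ?_
          have := sum_exp_signed_sum_le O B (h𝒜 B hB) (-l)
          rwa [neg_sq] at this
      _ = _ := by
          simp only [Finset.sum_const, Finset.card_powerset, nsmul_eq_mul]
          push_cast
          ring
  obtain ⟨P, hP, h2⟩ := Finset.exists_le_of_sum_le ⟨∅, Finset.empty_mem_powerset O⟩ h1
  refine ⟨P, Finset.mem_powerset.1 hP, fun B hB => ?_⟩
  have h3 : Real.exp (l * s P B) + Real.exp (-l * s P B) ≤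
      2 * 𝒜.card * Real.exp (l ^ 2 * O.card / 2) :=
    le_trans (Finset.single_le_sum
      (f := fun B => Real.exp (l * s P B) + Real.exp (-l * s P B))
      (fun _ _ => by positivity) hB) h2
  have h4 : Real.exp (l * |s P B|) ≤ 2 * 𝒜.card * Real.exp (l ^ 2 * O.card / 2) := by
    refine le_trans ?_ h3
    rcases abs_cases (s P B) with ⟨h, _⟩ | ⟨h, _⟩ <;> rw [h]
    · exact le_add_of_nonneg_right (Real.exp_pos _).le
    · rw [mul_neg, ← neg_mul]
      exact le_add_of_nonneg_left (Real.exp_pos _).le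
  have h5 : (0 : ℝ) < 𝒜.card := by exact_mod_cast Finset.card_pos.2 ⟨B, hB⟩
  have h6 := Real.log_le_log (Real.exp_pos _) h4
  rwa [Real.log_exp, Real.log_mul (by positivity) (Real.exp_pos _).ne', Real.log_exp] at h6

open Classical in
/-- The family `F` of sets has polynomial growth of degree `d`: it has at most `(n + 1) ^ d` traces
on every set of size `n`. -/
def PolyGrowth (F : Set (Set X)) (d : ℕ) : Prop :=
  ∀ O : Finset X, ∃ 𝒜 ⊆ O.powerset, 𝒜.card ≤ (O.card + 1) ^ d ∧ ∀ Y ∈ F, {x ∈ O | x ∈ Y} ∈ 𝒜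

open Classical in
/-- The mass given to `Y` by the integer weights `w` on the finite set `A`. -/
noncomputable def mass (A : Finset X) (w : X → ℕ) (Y : Set X) : ℝ := ∑ x ∈ A with x ∈ Y, (w x : ℝ)

lemma mass_nonneg (A : Finset X) (w : X → ℕ) (Y : Set X) : 0 ≤ mass A w Y :=
  Finset.sum_nonneg fun _ _ => by positivity

lemma mass_le_univ (A : Finset X) (w : X → ℕ) (Y : Set X) : mass A w Y ≤ mass A w Set.univ :=
  Finset.sum_le_sum_of_subset_of_nonneg (fun x hx => by simp at hx ⊢; exact hx.1)
    fun _ _ _ => by positivity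

lemma mass_univ (A : Finset X) (w : X → ℕ) : mass A w Set.univ = ((∑ x ∈ A, w x : ℕ) : ℝ) := by
  simp [mass]

open Classical in
/-- Weights can be halved with a discrepancy much smaller than the total mass, simultaneously for
all members of a family of polynomial growth: even weights are halved exactly, and odd weights are
rounded up or down according to a balanced choice of signs. -/
lemma PolyGrowth.exists_half {F : Set (Set X)} {d : ℕ} (hF : PolyGrowth F d) (A : Finset X)
    (w : X → ℕ) (hW : 1 ≤ mass A w Set.univ) :
    ∃ w' : X → ℕ, (∀ x, w' x ≤ (w x + 1) / 2) ∧ ∀ Y ∈ insert Set.univ F,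
      |2 * mass A w' Y - mass A w Y| ≤ (3 + 5 * d) * √√(mass A w Set.univ) ^ 3 := by
  set W := mass A w Set.univ with hWdef
  set t := √√W with ht
  have ht2 : t ^ 2 = √W := Real.sq_sqrt (Real.sqrt_nonneg _)
  have ht4 : t ^ 4 = W := by
    rw [show t ^ 4 = (t ^ 2) ^ 2 by ring, ht2, Real.sq_sqrt (by linarith)]
  have ht1 : 1 ≤ t := by
    rw [ht, Real.one_le_sqrt, Real.one_le_sqrt]
    exact hW
  set O : Finset X := {x ∈ A | Odd (w x)} with hO
  have hs : (O.card : ℝ) ≤ W := by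
    rw [hWdef, mass_univ]
    norm_cast
    rw [Finset.card_eq_sum_ones]
    calc ∑ x ∈ O, 1 ≤ ∑ x ∈ O, w x :=
          Finset.sum_le_sum fun x hx => (Finset.mem_filter.1 hx).2.pos
      _ ≤ _ := Finset.sum_le_sum_of_subset (Finset.filter_subset _ _)
  obtain ⟨𝒜, h𝒜, hcard, htrace⟩ := hF O
  obtain ⟨P, hPO, hP⟩ := exists_balanced_subset O (insert O 𝒜)
    (by
      intro B hB
      rcases Finset.mem_insert.1 hB with rfl | hB
      · exact subset_rfl
      · exact Finset.mem_powerset.1 (h𝒜 hB)) (1 / t ^ 2)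
  refine ⟨fun x => w x / 2 + if x ∈ P then 1 else 0, fun x => ?_, fun Y hY => ?_⟩
  · dsimp only
    split_ifs with h
    · obtain ⟨k, hk⟩ := (Finset.mem_filter.1 (hPO h)).2
      omega
    · omega
  have hB : {x ∈ O | x ∈ Y} ∈ insert O 𝒜 := by
    rcases hY with rfl | hY
    · simp
    · exact Finset.mem_insert_of_mem (htrace Y hY)
  have h1 : 2 * mass A (fun x => w x / 2 + if x ∈ P then 1 else 0) Y - mass A w Y =
      ∑ x ∈ O with x ∈ Y, (if x ∈ P then 1 else -1 : ℝ) := by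
    rw [mass, mass, Finset.mul_sum, ← Finset.sum_sub_distrib, hO, Finset.filter_filter]
    simp_rw [and_comm (a := Odd _)]
    rw [← Finset.filter_filter, Finset.sum_filter (p := fun x => Odd (w x))]
    refine Finset.sum_congr rfl fun x _ => ?_
    by_cases hx : Odd (w x)
    · obtain ⟨k, hk⟩ := hx
      have h2 : w x / 2 = k := by omega
      have h3 : Odd (w x) := ⟨k, hk⟩
      simp only [h3, if_true]
      rw [h2, hk]
      split_ifs <;> push_cast <;> ring
    · have h2 : x ∉ P := fun h => hx (Finset.mem_filter.1 (hPO h)).2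
      obtain ⟨k, hk⟩ := Nat.not_odd_iff_even.1 hx
      have h3 : w x / 2 = k := by omega
      simp only [hx, h2, if_false]
      rw [h3, hk]
      push_cast
      ring
  rw [h1]
  set σ := |∑ x ∈ O with x ∈ Y, (if x ∈ P then 1 else -1 : ℝ)| with hσ
  have h2 : 1 / t ^ 2 * σ ≤ Real.log (2 * (insert O 𝒜).card) + (1 / t ^ 2) ^ 2 * O.card / 2 :=
    hP _ hB
  have h3 : (1 / t ^ 2) ^ 2 * O.card / 2 ≤ 1 / 2 := by
    have : (1 / t ^ 2) ^ 2 * O.card ≤ 1 := by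
      rw [show (1 / t ^ 2) ^ 2 = 1 / t ^ 4 by ring, ht4, one_div, inv_mul_le_iff₀ (by linarith)]
      linarith
    linarith
  have h4 : Real.log (W + 1) ≤ 5 * t := by
    have h5 : Real.log (W + 1) ≤ Real.log (2 * t ^ 4) := by
      apply Real.log_le_log (by linarith)
      rw [ht4]
      linarith
    rw [Real.log_mul (by norm_num) (by positivity), Real.log_pow] at h5
    have := Real.log_two_lt_d9
    have := Real.log_le_sub_one_of_pos (show 0 < t by linarith)
    push_cast at h5
    linarith
  have h5 : Real.log (2 * (insert O 𝒜).card) ≤ 2 + d * (5 * t) := by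
    have h6 : ((insert O 𝒜).card : ℝ) ≤ 2 * (W + 1) ^ d := by
      have h7 : ((insert O 𝒜).card : ℝ) ≤ 𝒜.card + 1 := by
        exact_mod_cast Finset.card_insert_le _ _
      have h8 : (𝒜.card : ℝ) ≤ (O.card + 1) ^ d := by exact_mod_cast hcard
      have h9 : ((O.card : ℝ) + 1) ^ d ≤ (W + 1) ^ d := by gcongr
      have : 1 ≤ (W + 1) ^ d := one_le_pow₀ (by linarith)
      linarith
    have h7 : Real.log (2 * (insert O 𝒜).card) ≤ Real.log (2 * 2 * (W + 1) ^ d) := by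
      apply Real.log_le_log
      · have : 0 < (insert O 𝒜).card := Finset.card_pos.2 ⟨O, Finset.mem_insert_self _ _⟩
        positivity
      · linarith
    have h9 : Real.log (2 * 2 * (W + 1) ^ d) = Real.log 2 + Real.log 2 + d * Real.log (W + 1) := by
      rw [Real.log_mul (by norm_num) (by positivity), Real.log_pow,
        Real.log_mul (by norm_num) (by norm_num)]
    have := Real.log_two_lt_d9
    have h8 : d * Real.log (W + 1) ≤ d * (5 * t) := by gcongr
    linarith
  have h6 : σ ≤ t ^ 2 * (2 + d * (5 * t) + 1 / 2) := by
    have h7 : 1 / t ^ 2 * σ ≤ 2 + d * (5 * t) + 1 / 2 := by linarith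
    rwa [one_div, inv_mul_le_iff₀ (by positivity)] at h7
  refine h6.trans ?_
  rw [show (3 + 5 * (d : ℝ)) * t ^ 3 = t ^ 2 * ((3 + 5 * d) * t) by ring]
  gcongr
  linarith

/-- A bound for the total relative error of repeated halving down to total mass `W`. The factor `20`
makes its increase under one halving at least the relative error of that halving. -/
noncomputable def halvingError (d : ℕ) (W : ℝ) : ℝ := 20 * (3 + 5 * d) / √√W

lemma halvingError_nonneg (d : ℕ) (W : ℝ) : 0 ≤ halvingError d W := by
  unfold halvingError
  positivity

lemma halvingError_anti (d : ℕ) {V W : ℝ} (hV : 0 < V) (h : V ≤ W) :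
    halvingError d W ≤ halvingError d V := by
  unfold halvingError
  have : 0 < √√V := Real.sqrt_pos.2 (Real.sqrt_pos.2 hV)
  gcongr

lemma tendsto_halvingError (d : ℕ) :
    Filter.Tendsto (fun n : ℕ => halvingError d n) Filter.atTop (nhds 0) := by
  unfold halvingError
  apply Filter.Tendsto.const_div_atTop
  exact Real.tendsto_sqrt_atTop.comp (Real.tendsto_sqrt_atTop.comp tendsto_natCast_atTop_atTop)

/-- One step of halving; the relative error and the relative loss of mass are paid for by the
potential `halvingError`. -/
lemma PolyGrowth.exists_half_relative {F : Set (Set X)} {d : ℕ} (hF : PolyGrowth F d) (A : Finset X)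
    (w : X → ℕ) (hW : (3 * (3 + 5 * d)) ^ 4 ≤ mass A w Set.univ) :
    ∃ w' : X → ℕ, (∀ x, w' x ≤ (w x + 1) / 2) ∧
      mass A w Set.univ / 3 ≤ mass A w' Set.univ ∧
      mass A w' Set.univ ≤ 2 * mass A w Set.univ / 3 ∧
      mass A w Set.univ / 2 *
        (1 - (halvingError d (mass A w' Set.univ) - halvingError d (mass A w Set.univ))) ≤
          mass A w' Set.univ ∧
      ∀ Y ∈ F, |mass A w' Y / mass A w' Set.univ - mass A w Y / mass A w Set.univ| ≤
        halvingError d (mass A w' Set.univ) - halvingError d (mass A w Set.univ) := by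
  set W := mass A w Set.univ with hWdef
  set c : ℝ := 3 + 5 * d with hc
  have hc3 : 3 ≤ c := by rw [hc]; linarith [(Nat.cast_nonneg d : (0 : ℝ) ≤ d)]
  have hW1 : 1 ≤ W := le_trans (one_le_pow₀ (by linarith)) hW
  obtain ⟨w', hw', hY⟩ := hF.exists_half A w hW1
  rw [← hWdef, ← hc] at hY
  set t := √√W with ht
  have ht4 : t ^ 4 = W := by
    rw [show t ^ 4 = (t ^ 2) ^ 2 by ring, Real.sq_sqrt (Real.sqrt_nonneg _),
      Real.sq_sqrt (by linarith)]
  have ht0 : 0 ≤ t := Real.sqrt_nonneg _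
  have htc : 3 * c ≤ t := by
    rw [← ht4] at hW
    exact le_of_pow_le_pow_left₀ (by norm_num) ht0 hW
  have htpos : 0 < t := by linarith
  have hD : c * t ^ 3 ≤ W / 3 := by
    rw [← ht4]
    nlinarith [pow_pos htpos 3]
  have hU := hY Set.univ (Set.mem_insert _ _)
  rw [← hWdef] at hU
  set W' := mass A w' Set.univ with hW'def
  obtain ⟨hU1, hU2⟩ := abs_le.1 hU
  have hW'1 : W / 3 ≤ W' := by linarith
  have hW'2 : W' ≤ 2 * W / 3 := by linarith
  have hW'pos : 0 < W' := by linarith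
  set t' := √√W' with ht'
  have ht'4 : t' ^ 4 = W' := by
    rw [show t' ^ 4 = (t' ^ 2) ^ 2 by ring, Real.sq_sqrt (Real.sqrt_nonneg _),
      Real.sq_sqrt (by linarith)]
  have ht'pos : 0 < t' := Real.sqrt_pos.2 (Real.sqrt_pos.2 hW'pos)
  -- the constant 1.1 satisfies `1.1 ^ 4 ≤ 3 / 2`
  have htt' : 1.1 * t' ≤ t := by
    refine le_of_pow_le_pow_left₀ (n := 4) (by norm_num) ht0 ?_
    rw [mul_pow, ht4, ht'4]
    norm_num
    linarith
  have hpot : 2 * c / t ≤ halvingError d W' - halvingError d W := by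
    unfold halvingError
    rw [← ht, ← ht', ← hc]
    have h1 : 1.1 / t ≤ 1 / t' := by
      rw [div_le_div_iff₀ htpos ht'pos]
      linarith
    have h2 : 20 * c * (1.1 / t) ≤ 20 * c * (1 / t') := by gcongr
    have h3 : 20 * c * (1.1 / t) - 20 * c / t = 2 * c / t := by
      field_simp
      norm_num
    have h4 : 20 * c * (1 / t') = 20 * c / t' := by ring
    linarith
  have hrel : c * t ^ 3 = W * (c / t) := by
    rw [← ht4]
    field_simp
  refine ⟨w', hw', hW'1, hW'2, ?_, fun Y hYF => ?_⟩
  · have h1 : W / 2 * (1 - (halvingError d W' - halvingError d W)) ≤ W / 2 * (1 - 2 * c / t) := by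
      gcongr
    refine h1.trans ?_
    have h2 : W / 2 * (1 - 2 * c / t) = W / 2 - W * (c / t) := by ring
    have h3 : 0 ≤ W * (c / t) := by positivity
    linarith
  · refine le_trans ?_ hpot
    have h1 := hY Y (Set.mem_insert_of_mem _ hYF)
    have h2 := mass_nonneg A w' Y
    have h3 := mass_le_univ A w' Y
    rw [← hW'def] at h3
    set m := mass A w Y
    set m' := mass A w' Y
    have h4 : m' / W' - m / W = (m' / W' * (W - 2 * W') + (2 * m' - m)) / W := by
      have : W ≠ 0 := by linarith
      field_simp
      ring
    rw [h4, abs_div, abs_of_pos (show 0 < W by linarith), div_le_iff₀ (by linarith)]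
    have h5 : |m' / W' * (W - 2 * W')| ≤ c * t ^ 3 := by
      rw [abs_mul, abs_of_nonneg (by positivity), abs_sub_comm]
      calc _ ≤ 1 * (c * t ^ 3) := by
            gcongr
            exact div_le_one_of_le₀ h3 hW'pos.le
        _ = _ := one_mul _
    calc _ ≤ c * t ^ 3 + c * t ^ 3 := (abs_add_le _ _).trans (add_le_add h5 h1)
      _ = 2 * c / t * W := by rw [hrel]; ring

/-- Weights are halved until their total mass is of the order of `N`. -/
lemma PolyGrowth.exists_mass_le {F : Set (Set X)} {d : ℕ} (hF : PolyGrowth F d) (N : ℕ)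
    (hN : (3 * (3 + 5 * d)) ^ 4 ≤ (N : ℝ)) (A : Finset X) :
    ∀ (n : ℕ) (w : X → ℕ), ∑ x ∈ A, w x = n → N ≤ n →
    ∃ w' : X → ℕ, (N : ℝ) ≤ mass A w' Set.univ ∧ mass A w' Set.univ ≤ 3 * N ∧
      ∀ Y ∈ F, |mass A w' Y / mass A w' Set.univ - mass A w Y / mass A w Set.univ| ≤
        halvingError d (mass A w' Set.univ) - halvingError d (mass A w Set.univ) := by
  intro n
  induction n using Nat.strong_induction_on with
  | _ n ih =>
  intro w hw hn
  have hw' : mass A w Set.univ = n := by rw [mass_univ, hw]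
  have hn' : (N : ℝ) ≤ n := by exact_mod_cast hn
  by_cases h : n ≤ 3 * N
  · refine ⟨w, by rw [hw']; exact hn', ?_, fun Y _ => by simp⟩
    rw [hw']
    exact_mod_cast h
  · obtain ⟨w₁, -, h1, h2, -, h3⟩ := hF.exists_half_relative A w (by rw [hw']; linarith)
    rw [hw'] at h1 h2
    have h4 : ((3 * N : ℕ) : ℝ) < n := by exact_mod_cast not_le.1 h
    push_cast at h4
    obtain ⟨w₂, h5, h6, h7⟩ := ih (∑ x ∈ A, w₁ x) (by
        rw [mass_univ] at h2
        have : (((∑ x ∈ A, w₁ x : ℕ)) : ℝ) < n := by linarith [(Nat.cast_nonneg N : (0 : ℝ) ≤ N)]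
        exact_mod_cast this) w₁ rfl (by
        rw [mass_univ] at h1
        have : (N : ℝ) ≤ ((∑ x ∈ A, w₁ x : ℕ) : ℝ) := by linarith
        exact_mod_cast this)
    refine ⟨w₂, h5, h6, fun Y hY => ?_⟩
    have := abs_sub_le (mass A w₂ Y / mass A w₂ Set.univ) (mass A w₁ Y / mass A w₁ Set.univ)
      (mass A w Y / mass A w Set.univ)
    linarith [h3 Y hY, h7 Y hY]

/-- Existence of `ε`-approximations of bounded size: for a family of polynomial growth, every
finite weighting is uniformly close to one whose total mass is bounded in terms of `d` and `ε`. -/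
theorem exists_bounded_approximation (d : ℕ) {ε : ℝ} (hε : 0 < ε) :
    ∃ N : ℕ, ∀ {X : Type v} {F : Set (Set X)}, PolyGrowth F d → ∀ (A : Finset X) (w : X → ℕ),
      0 < ∑ x ∈ A, w x → ∃ w' : X → ℕ, 0 < ∑ x ∈ A, w' x ∧ ∑ x ∈ A, w' x ≤ N ∧
        ∀ Y ∈ F, |mass A w' Y / mass A w' Set.univ - mass A w Y / mass A w Set.univ| ≤ ε := by
  obtain ⟨N, h1, h2⟩ := (((tendsto_halvingError d).eventually_lt_const hε).and
    (Filter.tendsto_atTop.1 (tendsto_natCast_atTop_atTop (R := ℝ))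
      ((3 * (3 + 5 * d)) ^ 4))).exists
  have hN : (0 : ℝ) < N := lt_of_lt_of_le (by positivity) h2
  refine ⟨3 * N, fun {X F} hF A w hw => ?_⟩
  by_cases h : N ≤ ∑ x ∈ A, w x
  · obtain ⟨w', h3, h4, h5⟩ := hF.exists_mass_le N h2 A _ w rfl h
    refine ⟨w', ?_, ?_, fun Y hY => ?_⟩
    · rw [mass_univ] at h3
      exact_mod_cast hN.trans_le h3
    · rw [mass_univ] at h4
      exact_mod_cast h4
    · have := h5 Y hY
      have := halvingError_anti d hN h3
      have := halvingError_nonneg d (mass A w Set.univ)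
      linarith
  · exact ⟨w, hw, by omega, fun Y _ => by simpa using hε.le⟩

/-- If all weights are at most `2 ^ j`, then after `j` halvings they are at most `1`. The total mass
is halved `j` times up to a factor that is again controlled by the potential, so it stays large. -/
lemma PolyGrowth.exists_le_one {F : Set (Set X)} {d : ℕ} (hF : PolyGrowth F d) (N : ℝ)
    (hN : 3 * (3 * (3 + 5 * d)) ^ 4 ≤ N) (hN' : halvingError d (N / 3) ≤ 1 / 2) (A : Finset X) :
    ∀ (j : ℕ) (w : X → ℕ), (∀ x, w x ≤ 2 ^ j) → 2 ^ j * N ≤ mass A w Set.univ →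
    2 ^ j * (2 * N) ≤ mass A w Set.univ * (1 + 2 * halvingError d (mass A w Set.univ)) →
    ∃ w' : X → ℕ, (∀ x, w' x ≤ 1) ∧ N ≤ mass A w' Set.univ ∧
      ∀ Y ∈ F, |mass A w' Y / mass A w' Set.univ - mass A w Y / mass A w Set.univ| ≤
        halvingError d (mass A w' Set.univ) - halvingError d (mass A w Set.univ) := by
  have hNpos : 0 < N := lt_of_lt_of_le (by positivity) hN
  intro j
  induction j with
  | zero =>
    intro w hw h1 _
    exact ⟨w, by simpa using hw, by simpa using h1, fun Y _ => by simp⟩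
  | succ j ih =>
    intro w hw h1 h2
    have h2j : (1 : ℝ) ≤ 2 ^ j := one_le_pow₀ (by norm_num)
    have h2j' : 2 * N ≤ 2 ^ (j + 1) * N := by
      rw [pow_succ]
      nlinarith
    obtain ⟨w₁, h3, h4, h5, h6, h7⟩ := hF.exists_half_relative A w (by linarith)
    set W := mass A w Set.univ
    set W' := mass A w₁ Set.univ
    have h8 : halvingError d W' ≤ 1 / 2 :=
      (halvingError_anti d (by linarith) (show N / 3 ≤ W' by linarith)).trans hN'
    have h9 : halvingError d W ≤ halvingError d W' :=
      halvingError_anti d (by linarith) (by linarith)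
    have h10 := halvingError_nonneg d W
    set e := halvingError d W
    set e' := halvingError d W'
    have h11 : 2 ^ j * (2 * N) ≤ W' * (1 + 2 * e') := by
      rw [pow_succ] at h2
      have h12 : W / 2 * (1 - (e' - e)) * (1 + 2 * e') ≤ W' * (1 + 2 * e') := by
        have : 0 ≤ 1 + 2 * e' := by linarith
        gcongr
      -- `(1 - Δ) (1 + 2 (e + Δ)) ≥ 1 + 2 e` as long as `e + Δ ≤ 1 / 2`
      have h13 : W / 2 * (1 + 2 * e) ≤ W / 2 * ((1 - (e' - e)) * (1 + 2 * e')) := by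
        have : 0 ≤ W / 2 := by linarith
        gcongr
        nlinarith
      nlinarith
    obtain ⟨w₂, h12, h13, h14⟩ := ih w₁ (fun x => by
        have := h3 x
        have := hw x
        rw [pow_succ] at this
        omega) (by
        have : W' * (1 + 2 * e') ≤ W' * 2 := by
          have : 0 ≤ W' := by linarith
          gcongr
          linarith
        linarith) h11
    refine ⟨w₂, h12, h13, fun Y hY => ?_⟩
    have := abs_sub_le (mass A w₂ Y / mass A w₂ Set.univ) (mass A w₁ Y / mass A w₁ Set.univ)
      (mass A w Y / mass A w Set.univ)
    linarith [h7 Y hY, h14 Y hY]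

open Classical in
/-- A weighting in which every point has small relative weight is uniformly close, on a family of
polynomial growth, to the normalized counting measure of a large finite set. -/
theorem exists_finset_approximation (d K : ℕ) {ε : ℝ} (hε : 0 < ε) :
    ∃ δ : ℝ, 0 < δ ∧ ∀ {X : Type v} {F : Set (Set X)}, PolyGrowth F d →
      ∀ (A : Finset X) (w : X → ℕ), 0 < ∑ x ∈ A, w x →
        (∀ x ∈ A, (w x : ℝ) ≤ δ * mass A w Set.univ) →
        ∃ B : Finset X, K ≤ B.card ∧ ∀ Y ∈ F,
          |(({x ∈ B | x ∈ Y}.card : ℝ)) / B.card - mass A w Y / mass A w Set.univ| ≤ ε := by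
  obtain ⟨N, ⟨h1, h1'⟩, h2, h3⟩ := (((tendsto_halvingError d).eventually_lt_const hε).and
    ((tendsto_halvingError d).eventually_lt_const (show (0 : ℝ) < 1 / 2 by norm_num)) |>.and
    ((Filter.tendsto_atTop.1 (tendsto_natCast_atTop_atTop (R := ℝ))
      ((3 * (3 + 5 * d)) ^ 4)).and (Filter.eventually_ge_atTop K))).exists
  have hN : (0 : ℝ) < N := lt_of_lt_of_le (by positivity) h2
  refine ⟨1 / (4 * (3 * N)), by positivity, fun {X F} hF A w hw hδ => ?_⟩
  set W := mass A w Set.univ with hWdef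
  have hW : 0 < W := by
    rw [hWdef, mass_univ]
    exact_mod_cast hw
  set m := A.sup w with hm
  have hmle : ∀ x ∈ A, w x ≤ m := fun x hx => Finset.le_sup hx
  have hmW : (4 * (3 * N)) * m ≤ W := by
    have hne : A.Nonempty := by
      rw [Finset.nonempty_iff_ne_empty]
      rintro rfl
      simp at hw
    obtain ⟨x, hx, hxm⟩ := Finset.exists_mem_eq_sup A hne w
    have := hδ x hx
    rw [hm, hxm]
    rw [div_mul_eq_mul_div, le_div_iff₀ (by positivity)] at this
    linarith
  have hm1 : 1 ≤ m := by
    by_contra hm0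
    have : ∑ x ∈ A, w x = 0 := Finset.sum_eq_zero fun x hx => by
      have := hmle x hx
      omega
    omega
  set j := Nat.log 2 m + 1 with hj
  have hj1 : m ≤ 2 ^ j := (Nat.lt_pow_succ_log_self (by norm_num) m).le
  have hj2 : (2 : ℝ) ^ j ≤ 2 * m := by
    have : 2 ^ j ≤ 2 * m := by
      rw [hj, pow_succ, mul_comm]
      exact Nat.mul_le_mul_left 2 (Nat.pow_log_le_self 2 (by omega))
    exact_mod_cast this
  -- outside `A` the weights play no role, but they have to be bounded as well
  set v : X → ℕ := fun x => if x ∈ A then w x else 0 with hv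
  have hmass : ∀ Y, mass A v Y = mass A w Y := fun Y => Finset.sum_congr rfl fun x hx => by
    simp [hv, (Finset.mem_filter.1 hx).1]
  have hjW : 2 ^ j * (2 * (3 * N)) ≤ W := by
    have : (2 : ℝ) ^ j * (2 * (3 * N)) ≤ (2 * m) * (2 * (3 * N)) := by gcongr
    linarith
  obtain ⟨w', hw'1, hw'2, hw'3⟩ := hF.exists_le_one (3 * N) (by linarith)
    (by rw [mul_div_cancel_left₀ _ (by norm_num : (3 : ℝ) ≠ 0)]; exact h1'.le) A j v
    (fun x => by
      simp only [hv]
      split_ifs with hx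
      · exact (hmle x hx).trans hj1
      · exact Nat.zero_le _)
    (by
      rw [hmass, ← hWdef]
      have : (0 : ℝ) < 2 ^ j := by positivity
      nlinarith)
    (by
      rw [hmass, ← hWdef]
      have := halvingError_nonneg d W
      nlinarith)
  have hcount : ∀ Y, mass A w' Y =
      (({x ∈ ({x ∈ A | w' x = 1} : Finset X) | x ∈ Y}.card : ℕ) : ℝ) := by
    intro Y
    rw [mass, Finset.filter_filter, Finset.card_eq_sum_ones, Nat.cast_sum]
    simp_rw [and_comm (a := w' _ = 1)]
    rw [← Finset.filter_filter, Finset.sum_filter (p := fun x => w' x = 1)]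
    refine Finset.sum_congr rfl fun x _ => ?_
    have := hw'1 x
    interval_cases w' x <;> simp
  have hcount' : mass A w' Set.univ = (({x ∈ A | w' x = 1} : Finset X).card : ℝ) := by
    rw [hcount]
    simp
  refine ⟨{x ∈ A | w' x = 1}, ?_, fun Y hY => ?_⟩
  · rw [hcount'] at hw'2
    have h4 : (K : ℝ) ≤ N := by exact_mod_cast h3
    have : (K : ℝ) ≤ (({x ∈ A | w' x = 1} : Finset X).card : ℝ) := by linarith
    exact_mod_cast this
  · have h4 := hw'3 Y hY
    rw [hmass, hmass, ← hWdef] at h4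
    rw [← hcount, ← hcount']
    have := halvingError_anti d hN (show (N : ℝ) ≤ mass A w' Set.univ by linarith)
    have := halvingError_nonneg d W
    linarith

end Approximation

/-! ### Definable subsets of a sort and Keisler measures -/

namespace DefSort

variable {T : L.Theory} (S : DefSort T)

/-- The formula `∃ x', x' ∼ x ∧ φ(x'; y)`, the closure of `φ` under the equivalence relation of
the sort `S`. -/
noncomputable def saturate {m : ℕ} (φ : L.Formula (Fin S.arity ⊕ Fin m)) :
    L.Formula (Fin S.arity ⊕ Fin m) :=
  Language.Formula.iExs (Fin S.arity)
    (S.dom.relabel (Sum.inr : _ → (Fin S.arity ⊕ Fin m) ⊕ Fin S.arity) ⊓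
      (S.rel.relabel (Sum.elim Sum.inr (Sum.inl ∘ Sum.inl)) ⊓
        φ.relabel (Sum.elim Sum.inr (Sum.inl ∘ Sum.inr))))

/-- A formula defining the intersection of the sets defined by `φ` and `ψ`. Both formulas have to be
saturated first: an element of the intersection may have no representative satisfying both. -/
noncomputable def interFormula {m m' : ℕ} (φ : L.Formula (Fin S.arity ⊕ Fin m))
    (ψ : L.Formula (Fin S.arity ⊕ Fin m')) : L.Formula (Fin S.arity ⊕ Fin (m + m')) :=
  (S.saturate φ).relabel (Sum.map id (Fin.castAdd m')) ⊓
    (S.saturate ψ).relabel (Sum.map id (Fin.natAdd m))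

/-- A formula defining, according to whether its two last parameters agree or not, the sets
defined by `φ` or those defined by `ψ`. -/
noncomputable def caseFormula {m m' : ℕ} (φ : L.Formula (Fin S.arity ⊕ Fin m))
    (ψ : L.Formula (Fin S.arity ⊕ Fin m')) : L.Formula (Fin S.arity ⊕ Fin (m + m' + 2)) :=
  let e : L.Formula (Fin S.arity ⊕ Fin (m + m' + 2)) :=
    Language.Term.equal (Language.var (Sum.inr (Fin.natAdd (m + m') 0)))
      (Language.var (Sum.inr (Fin.natAdd (m + m') 1)))
  (e ⊓ φ.relabel (Sum.map id (Fin.castAdd 2 ∘ Fin.castAdd m'))) ⊔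
    (∼e ⊓ ψ.relabel (Sum.map id (Fin.castAdd 2 ∘ Fin.natAdd m)))

variable {M : Type (max u v)} [L.Structure M] [Nonempty M] [M ⊨ T]

lemma toElem_eq_iff (x y : S.Rep M) :
    S.toElem x = S.toElem y ↔ S.rel.Realize (Sum.elim x.1 y.1) := Quotient.eq

lemma exists_toElem (s : S.Elem M) : ∃ x, S.toElem x = s := Quotient.exists_rep s

lemma realize_saturate {m : ℕ} (φ : L.Formula (Fin S.arity ⊕ Fin m)) (x : S.Rep M)
    (b : Fin m → M) :
    (S.saturate φ).Realize (Sum.elim x.1 b) ↔ S.toElem x ∈ S.definedBy φ b := by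
  unfold saturate definedBy
  simp only [Language.Formula.realize_iExs, Language.Formula.realize_inf,
    Language.Formula.realize_relabel, Set.mem_ofPred_eq, toElem_eq_iff]
  have h1 (i : Fin S.arity → M) : Sum.elim (Sum.elim x.1 b) i ∘ Sum.inr = i := rfl
  have h2 (i : Fin S.arity → M) : Sum.elim (Sum.elim x.1 b) i ∘
      Sum.elim Sum.inr (Sum.inl ∘ Sum.inl) = Sum.elim i x.1 := by
    ext j; rcases j <;> rfl
  have h3 (i : Fin S.arity → M) : Sum.elim (Sum.elim x.1 b) i ∘
      Sum.elim Sum.inr (Sum.inl ∘ Sum.inr) = Sum.elim i b := by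
    ext j; rcases j <;> rfl
  simp only [h1, h2, h3]
  exact ⟨fun ⟨i, h, h'⟩ => ⟨⟨i, h⟩, h'⟩, fun ⟨i, h'⟩ => ⟨i.1, i.2, h'⟩⟩

lemma definedBy_inter {m m' : ℕ} (φ : L.Formula (Fin S.arity ⊕ Fin m))
    (ψ : L.Formula (Fin S.arity ⊕ Fin m')) (b : Fin m → M) (c : Fin m' → M) :
    S.definedBy (S.interFormula φ ψ) (Fin.append b c) = S.definedBy φ b ∩ S.definedBy ψ c := by
  have h (x : S.Rep M) : (S.interFormula φ ψ).Realize (Sum.elim x.1 (Fin.append b c)) ↔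
      S.toElem x ∈ S.definedBy φ b ∩ S.definedBy ψ c := by
    rw [Set.mem_inter_iff, ← realize_saturate, ← realize_saturate, interFormula,
      Language.Formula.realize_inf, Language.Formula.realize_relabel,
      Language.Formula.realize_relabel]
    have h1 : Sum.elim x.1 (Fin.append b c) ∘ Sum.map id (Fin.castAdd m') = Sum.elim x.1 b := by
      ext j; rcases j <;> simp
    have h2 : Sum.elim x.1 (Fin.append b c) ∘ Sum.map id (Fin.natAdd m) = Sum.elim x.1 c := by
      ext j; rcases j <;> simp
    rw [h1, h2]
  ext s
  constructor
  · rintro ⟨x, rfl, hx⟩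
    exact (h x).1 hx
  · intro hs
    obtain ⟨x, rfl⟩ := S.exists_toElem s
    exact ⟨x, rfl, (h x).2 hs⟩

lemma definedBy_rel (x : S.Rep M) : S.definedBy S.rel x.1 = {S.toElem x} := by
  ext s
  simp only [definedBy, Set.mem_ofPred_eq, Set.mem_singleton_iff, ← toElem_eq_iff]
  exact ⟨fun ⟨y, h, h'⟩ => h ▸ h', fun h => ⟨x, h.symm, rfl⟩⟩

lemma definedBy_caseFormula_self {m m' : ℕ} (φ : L.Formula (Fin S.arity ⊕ Fin m))
    (ψ : L.Formula (Fin S.arity ⊕ Fin m')) (b : Fin m → M) (c : Fin m' → M) (u : M) :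
    S.definedBy (S.caseFormula φ ψ) (Fin.append (Fin.append b c) ![u, u]) = S.definedBy φ b := by
  ext s
  have h1 (x : S.Rep M) : Sum.elim x.1 (Fin.append (Fin.append b c) ![u, u]) ∘
      Sum.map id (Fin.castAdd 2 ∘ Fin.castAdd m') = Sum.elim x.1 b := by
    ext j; rcases j <;> simp
  simp only [caseFormula, definedBy, Language.Formula.realize_sup, Language.Formula.realize_inf,
    Language.Formula.realize_not, Language.Formula.realize_equal, Language.Formula.realize_relabel,
    Language.Term.realize_var, Sum.elim_inr, Fin.append_right, h1, Set.mem_ofPred_eq]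
  simp

lemma definedBy_caseFormula_of_ne {m m' : ℕ} (φ : L.Formula (Fin S.arity ⊕ Fin m))
    (ψ : L.Formula (Fin S.arity ⊕ Fin m')) (b : Fin m → M) (c : Fin m' → M) {u v : M}
    (huv : u ≠ v) :
    S.definedBy (S.caseFormula φ ψ) (Fin.append (Fin.append b c) ![u, v]) = S.definedBy ψ c := by
  ext s
  have h1 (x : S.Rep M) : Sum.elim x.1 (Fin.append (Fin.append b c) ![u, v]) ∘
      Sum.map id (Fin.castAdd 2 ∘ Fin.natAdd m) = Sum.elim x.1 c := by
    ext j; rcases j <;> simp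
  simp only [caseFormula, definedBy, Language.Formula.realize_sup, Language.Formula.realize_inf,
    Language.Formula.realize_not, Language.Formula.realize_equal, Language.Formula.realize_relabel,
    Language.Term.realize_var, Sum.elim_inr, Fin.append_right, h1, Set.mem_ofPred_eq]
  simp [huv]

/-- Finitely many formulas can be coded in a single one, uniformly in the models with at least two
elements. -/
lemma exists_coding (l : List (Σ m : ℕ, L.Formula (Fin S.arity ⊕ Fin m))) :
    ∃ (m : ℕ) (ψ : L.Formula (Fin S.arity ⊕ Fin m)),
      ∀ (M : Type (max u v)) [L.Structure M] [Nonempty M] [M ⊨ T] [Nontrivial M],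
        ∀ p ∈ l, ∀ b : Fin p.1 → M, ∃ c : Fin m → M, S.definedBy ψ c = S.definedBy p.2 b := by
  induction l with
  | nil => exact ⟨0, ⊤, by simp⟩
  | cons q l ih =>
    obtain ⟨m, ψ, h⟩ := ih
    refine ⟨_, S.caseFormula q.2 ψ, fun M _ _ _ _ p hp b => ?_⟩
    obtain ⟨u, v, huv⟩ := exists_pair_ne M
    rcases List.mem_cons.1 hp with rfl | hp
    · exact ⟨_, S.definedBy_caseFormula_self _ ψ b (fun _ => u) u⟩
    · obtain ⟨c, hc⟩ := h M p hp b
      rw [← hc]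
      exact ⟨_, S.definedBy_caseFormula_of_ne q.2 ψ (fun _ => u) c huv⟩

lemma definable_dom {N : Type*} [L.Structure N] :
    (Set.univ : Set N).Definable L {x | S.dom.Realize x} := by
  rw [Set.definable_iff_exists_formula_sum]
  refine ⟨S.dom.relabel Sum.inr, ?_⟩
  ext x
  simp

lemma isDefinable_definedBy {m : ℕ} (φ : L.Formula (Fin S.arity ⊕ Fin m)) (b : Fin m → M) :
    S.IsDefinable (S.definedBy φ b) := by
  unfold IsDefinable
  rw [Set.definable_iff_exists_formula_sum]
  refine ⟨S.dom.relabel Sum.inr ⊓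
    (S.saturate φ).relabel (Sum.elim Sum.inr fun j => Sum.inl ⟨b j, trivial⟩), ?_⟩
  ext x
  have h : Sum.elim (fun a : ↥(Set.univ : Set M) => (a : M)) x ∘
      (Sum.elim Sum.inr fun j => Sum.inl ⟨b j, Set.mem_univ _⟩) = Sum.elim x b := by
    ext j; rcases j <;> rfl
  simp only [Set.mem_ofPred_eq, Language.Formula.realize_inf, Language.Formula.realize_relabel, h,
    Sum.elim_comp_inr]
  constructor
  · rintro ⟨h1, h2⟩
    exact ⟨h1, (S.realize_saturate φ ⟨x, h1⟩ b).2 h2⟩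
  · rintro ⟨h1, h2⟩
    exact ⟨h1, (S.realize_saturate φ ⟨x, h1⟩ b).1 h2⟩

lemma exists_formula_of_definable {N : Type*} [L.Structure N] {n : ℕ} {s : Set (Fin n → N)}
    (hs : (Set.univ : Set N).Definable L s) :
    ∃ (m : ℕ) (φ : L.Formula (Fin n ⊕ Fin m)) (b : Fin m → N),
      s = {x | φ.Realize (Sum.elim x b)} := by
  obtain ⟨A, -, hA⟩ := Set.definable_iff_finitely_definable.1 hs
  obtain ⟨φ, rfl⟩ := Set.definable_iff_exists_formula_sum.1 hA
  refine ⟨A.card, φ.relabel (Sum.elim (fun a => Sum.inr (A.equivFin a)) Sum.inl),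
    fun j => (A.equivFin.symm j : N), ?_⟩
  ext x
  simp only [Set.mem_ofPred_eq, Language.Formula.realize_relabel]
  have h : Sum.elim x (fun j => (A.equivFin.symm j : N)) ∘
      (Sum.elim (fun a => Sum.inr (A.equivFin a)) Sum.inl) = Sum.elim (fun a : A => (a : N)) x := by
    ext j; rcases j <;> simp
  rw [h]
  rfl

lemma isDefinable_iff {X : Set (S.Elem M)} :
    S.IsDefinable X ↔ ∃ (m : ℕ) (φ : L.Formula (Fin S.arity ⊕ Fin m)) (b : Fin m → M),
      X = S.definedBy φ b := by
  constructor
  · intro hX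
    obtain ⟨m, φ, b, h⟩ := exists_formula_of_definable hX
    refine ⟨m, φ, b, ?_⟩
    have h' (x : S.Rep M) : S.toElem x ∈ X ↔ φ.Realize (Sum.elim x.1 b) := by
      have := Set.ext_iff.1 h x.1
      simp only [Set.mem_ofPred_eq] at this
      rw [← this]
      exact ⟨fun h => ⟨x.2, h⟩, fun ⟨_, h⟩ => h⟩
    ext s
    constructor
    · intro hs
      obtain ⟨x, rfl⟩ := S.exists_toElem s
      exact ⟨x, rfl, (h' x).1 hs⟩
    · rintro ⟨x, rfl, hx⟩
      exact (h' x).2 hx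
  · rintro ⟨m, φ, b, rfl⟩
    exact S.isDefinable_definedBy φ b

variable {S}

lemma IsDefinable.inter {X Y : Set (S.Elem M)} (hX : S.IsDefinable X) (hY : S.IsDefinable Y) :
    S.IsDefinable (X ∩ Y) := by
  unfold IsDefinable at *
  convert Set.Definable.inter hX hY using 1
  ext x
  exact ⟨fun ⟨h, h1, h2⟩ => ⟨⟨h, h1⟩, h, h2⟩, fun ⟨⟨h, h1⟩, _, h2⟩ => ⟨h, h1, h2⟩⟩

lemma IsDefinable.compl {X : Set (S.Elem M)} (hX : S.IsDefinable X) : S.IsDefinable Xᶜ := by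
  unfold IsDefinable at *
  convert S.definable_dom.sdiff hX using 1
  ext x
  exact ⟨fun ⟨h, h1⟩ => ⟨h, fun ⟨_, h2⟩ => h1 h2⟩, fun ⟨h, h1⟩ => ⟨h, fun h2 => h1 ⟨h, h2⟩⟩⟩

lemma isDefinable_univ : S.IsDefinable (Set.univ : Set (S.Elem M)) := by
  unfold IsDefinable
  convert S.definable_dom (N := M) using 1
  ext x
  simp

lemma isDefinable_empty : S.IsDefinable (∅ : Set (S.Elem M)) := by
  simpa using (isDefinable_univ (S := S) (M := M)).compl

lemma isDefinable_singleton (c : S.Elem M) : S.IsDefinable {c} := by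
  obtain ⟨x, rfl⟩ := S.exists_toElem c
  rw [← definedBy_rel]
  exact S.isDefinable_definedBy _ _

lemma subsingleton_elem [Subsingleton M] (c d : S.Elem M) : c = d := by
  obtain ⟨x, rfl⟩ := S.exists_toElem c
  obtain ⟨y, rfl⟩ := S.exists_toElem d
  congr 1
  exact Subtype.ext (Subsingleton.elim _ _)

lemma nontrivial_of_ne {c d : S.Elem M} (h : c ≠ d) : Nontrivial M := by
  by_contra hM
  rw [not_nontrivial_iff_subsingleton] at hM
  exact h (subsingleton_elem c d)

end DefSort

namespace KeislerMeasure

variable {T : L.Theory} {S : DefSort T} {M : Type (max u v)} [L.Structure M] [Nonempty M] [M ⊨ T]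

variable (μ : KeislerMeasure S M)

lemma nonneg' (X : Set (S.Elem M)) : 0 ≤ μ.toFun X := by
  by_cases hX : S.IsDefinable X
  · exact μ.nonneg X hX
  · rw [μ.not_definable X hX]

lemma empty : μ.toFun ∅ = 0 := by
  have := μ.union ∅ ∅ DefSort.isDefinable_empty DefSort.isDefinable_empty (by simp)
  simp only [Set.union_self] at this
  linarith

lemma inter_add_diff {X Y : Set (S.Elem M)} (hX : S.IsDefinable X) (hY : S.IsDefinable Y) :
    μ.toFun (X ∩ Y) + μ.toFun (X ∩ Yᶜ) = μ.toFun X := by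
  rw [← μ.union _ _ (hX.inter hY) (hX.inter hY.compl), Set.inter_union_compl]
  exact (disjoint_compl_right (a := Y)).mono Set.inter_subset_right Set.inter_subset_right

lemma mono {X Y : Set (S.Elem M)} (hX : S.IsDefinable X) (hY : S.IsDefinable Y) (h : X ⊆ Y) :
    μ.toFun X ≤ μ.toFun Y := by
  have := μ.inter_add_diff hY hX
  rw [Set.inter_eq_right.2 h] at this
  linarith [μ.nonneg' (Y ∩ Xᶜ)]

lemma compl {X : Set (S.Elem M)} (hX : S.IsDefinable X) : μ.toFun Xᶜ = 1 - μ.toFun X := by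
  have := μ.inter_add_diff DefSort.isDefinable_univ hX
  rw [Set.univ_inter, Set.univ_inter, μ.univ] at this
  linarith

lemma le_one (X : Set (S.Elem M)) : μ.toFun X ≤ 1 := by
  by_cases hX : S.IsDefinable X
  · linarith [μ.compl hX, μ.nonneg' Xᶜ]
  · rw [μ.not_definable X hX]
    exact zero_le_one

lemma union_le {X Y : Set (S.Elem M)} (hX : S.IsDefinable X) (hY : S.IsDefinable Y) :
    μ.toFun (X ∪ Y) ≤ μ.toFun X + μ.toFun Y := by
  have h1 := μ.union X (Y ∩ Xᶜ) hX (hY.inter hX.compl)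
    ((disjoint_compl_right (a := X)).mono_right Set.inter_subset_right)
  have h2 : X ∪ Y ∩ Xᶜ = X ∪ Y := by
    rw [← Set.sdiff_eq, Set.union_sdiff_self]
  rw [h2] at h1
  linarith [μ.mono (hY.inter hX.compl) hY Set.inter_subset_left]

end KeislerMeasure

/-! ### NIP, approximation of generically stable measures, and cutting -/

lemma card_filter_card_lt_le {X : Type*} (O : Finset X) (d : ℕ) :
    {t ∈ O.powerset | t.card < d}.card ≤ (O.card + 1) ^ d := by
  classical
  have h1 : {t ∈ O.powerset | t.card < d} ⊆
      (Finset.range d).biUnion fun k => O.powersetCard k := by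
    intro t ht
    simp only [Finset.mem_filter, Finset.mem_powerset] at ht
    simp only [Finset.mem_biUnion, Finset.mem_range, Finset.mem_powersetCard]
    exact ⟨t.card, ht.2, ht.1, rfl⟩
  calc _ ≤ _ := Finset.card_le_card h1
    _ ≤ ∑ k ∈ Finset.range d, (O.powersetCard k).card := Finset.card_biUnion_le
    _ ≤ ∑ k ∈ Finset.range d, O.card ^ k * 1 ^ (d - k) * d.choose k := by
        refine Finset.sum_le_sum fun k hk => ?_
        rw [Finset.card_powersetCard, one_pow, mul_one]
        exact (Nat.choose_le_pow _ _).trans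
          (Nat.le_mul_of_pos_right _ (Nat.choose_pos (Finset.mem_range.1 hk).le))
    _ ≤ ∑ k ∈ Finset.range (d + 1), O.card ^ k * 1 ^ (d - k) * d.choose k :=
        Finset.sum_le_sum_of_subset (Finset.range_mono (Nat.le_succ d))
    _ = _ := (add_pow _ _ _).symm

open Classical in
/-- In a NIP theory, a formula defines families of sets of polynomial growth, with a degree that
does not depend on the model. This is the Sauer–Shelah lemma. -/
lemma IsNIP.exists_polyGrowth {T : L.Theory} (hT : IsNIP T) (S : DefSort T) {m : ℕ}
    (φ : L.Formula (Fin S.arity ⊕ Fin m)) :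
    ∃ d, ∀ (M : Type (max u v)) [L.Structure M] [Nonempty M] [M ⊨ T],
      PolyGrowth (Set.range fun b : Fin m → M => S.definedBy φ b) d := by
  obtain ⟨d, hd⟩ := hT _ _ (S.saturate φ)
  refine ⟨d, fun M _ _ _ O => ?_⟩
  set 𝒜 : Finset (Finset (S.Elem M)) :=
    {t ∈ O.powerset | ∃ b : Fin m → M, {x ∈ O | x ∈ S.definedBy φ b} = t} with h𝒜
  refine ⟨𝒜, Finset.filter_subset _ _, ?_, ?_⟩
  · refine (Finset.card_le_card_shatterer 𝒜).trans (le_trans (Finset.card_le_card ?_)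
      (card_filter_card_lt_le O d))
    intro t ht
    rw [Finset.mem_shatterer] at ht
    rw [Finset.mem_filter, Finset.mem_powerset]
    refine ⟨?_, ?_⟩
    · obtain ⟨w, hw, htw⟩ := ht.exists_superset
      exact htw.trans (Finset.mem_powerset.1 (Finset.mem_filter.1 hw).1)
    · by_contra hcard
      obtain ⟨t', ht', hcard'⟩ := Finset.exists_subset_card_eq (not_lt.1 hcard)
      have hsh := ht.mono_right ht'
      let e : t' ≃ Fin d := t'.equivFinOfCardEq hcard'
      choose ρ hρ using fun s : S.Elem M => S.exists_toElem s
      have key : ∀ s : Set (Fin d), ∃ b : Fin m → M, ∀ i : Fin d,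
          ((e.symm i : t') : S.Elem M) ∈ S.definedBy φ b ↔ i ∈ s := by
        intro s
        obtain ⟨w, hw, htw⟩ := hsh (t := {x ∈ t' | ∃ i ∈ s, ((e.symm i : t') : S.Elem M) = x})
          (Finset.filter_subset _ _)
        obtain ⟨hwO, b, rfl⟩ := Finset.mem_filter.1 hw
        refine ⟨b, fun i => ?_⟩
        have h1 := Finset.ext_iff.1 htw (e.symm i)
        have h2 : ((e.symm i : t') : S.Elem M) ∈ O := by
          obtain ⟨w', hw', htw'⟩ := hsh.exists_superset
          exact Finset.mem_powerset.1 (Finset.mem_filter.1 hw').1 (htw' (e.symm i).2)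
        simp only [Finset.mem_inter, Finset.coe_mem, Finset.mem_filter, h2, true_and,
          Subtype.coe_inj, e.symm.injective.eq_iff, exists_eq_right] at h1
        exact h1
      choose b hb using key
      refine hd M ⟨fun i => (ρ (e.symm i : t')).1, b, fun i s => ?_⟩
      rw [DefSort.realize_saturate, hρ, hb]
  · rintro _ ⟨b, rfl⟩
    exact Finset.mem_filter.2 ⟨Finset.mem_powerset.2 (Finset.filter_subset _ _), b, rfl⟩

open Classical in
lemma avg_eq_sum {A : Type*} {k : ℕ} (a : Fin k → A) (X : Set A) :
    avg a X = ∑ i, if a i ∈ X then (1 / k : ℝ) else 0 := by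
  rw [avg, ← Finset.sum_filter, Finset.sum_const, nsmul_eq_mul, Set.ncard_eq_toFinset_card']
  rw [mul_one_div]
  congr 3
  ext i
  simp

open Classical in
lemma exists_mass_eq_avg {A : Type*} {k : ℕ} (a : Fin k → A) :
    ∃ (B : Finset A) (w : A → ℕ), ∑ x ∈ B, w x = k ∧
      ∀ Y, mass B w Y / mass B w Set.univ = avg a Y := by
  have h (Y : Set A) : mass (Finset.univ.image a) (fun x => {i | a i = x}.ncard) Y =
      ({i | a i ∈ Y}.ncard : ℝ) := by
    unfold mass
    norm_cast
    rw [Set.ncard_eq_toFinset_card', Finset.card_eq_sum_card_fiberwise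
      (t := {x ∈ Finset.univ.image a | x ∈ Y}) (f := a) (fun i hi => by simpa using hi)]
    refine Finset.sum_congr rfl fun x hx => ?_
    rw [Set.ncard_eq_toFinset_card']
    congr 1
    ext i
    have := (Finset.mem_filter.1 hx).2
    simp only [Set.mem_toFinset, Set.mem_ofPred_eq, Finset.mem_filter]
    exact ⟨fun h => ⟨h ▸ this, h⟩, fun h => h.2⟩
  have hu : mass (Finset.univ.image a) (fun x => {i | a i = x}.ncard) Set.univ = k := by
    rw [h]
    simp
  refine ⟨Finset.univ.image a, fun x => {i | a i = x}.ncard, ?_, fun Y => ?_⟩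
  · rw [mass_univ] at hu
    exact_mod_cast hu
  · rw [hu, h, avg]

open Classical in
lemma exists_avg_eq_mass {A : Type*} (B : Finset A) (w : A → ℕ) :
    ∃ a : Fin (∑ x ∈ B, w x) → A, ∀ Y, avg a Y = mass B w Y / mass B w Set.univ := by
  have hcard : Fintype.card (Σ x : B, Fin (w x)) = ∑ x ∈ B, w x := by
    rw [Fintype.card_sigma, ← Finset.sum_coe_sort B]
    simp
  let e := Fintype.equivFinOfCardEq hcard
  refine ⟨fun i => (e.symm i).1, fun Y => ?_⟩
  rw [avg, mass_univ]
  congr 1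
  have h1 : {i | ((e.symm i).1 : A) ∈ Y} = e '' {p | (p.1 : A) ∈ Y} := by
    rw [Equiv.image_eq_preimage_symm]
    rfl
  rw [h1, Set.ncard_image_of_injective _ e.injective, Set.ncard_eq_toFinset_card', mass]
  norm_cast
  rw [Finset.sum_filter, ← Finset.sum_coe_sort B, Finset.card_eq_sum_ones]
  have h2 : ({p | (p.1 : A) ∈ Y} : Set (Σ x : B, Fin (w x))).toFinset =
      Finset.univ.sigma fun x : B => if (x : A) ∈ Y then Finset.univ else ∅ := by
    ext p
    simp only [Set.mem_toFinset, Set.mem_ofPred_eq, Finset.mem_sigma, Finset.mem_univ, true_and]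
    split_ifs with h <;> simp [h]
  rw [h2, Finset.sum_sigma]
  refine Finset.sum_congr rfl fun x _ => ?_
  split_ifs <;> simp

/-- In a NIP theory, the number of points needed to approximate a generically stable measure on
the instances of a formula is bounded independently of the measure and of the model. -/
lemma IsNIP.exists_uniform_approximation {T : L.Theory} (hT : IsNIP T) (S : DefSort T) {m : ℕ}
    (φ : L.Formula (Fin S.arity ⊕ Fin m)) {ε : ℝ} (hε : 0 < ε) :
    ∃ N : ℕ, ∀ (M : Type (max u v)) [L.Structure M] [Nonempty M] [M ⊨ T]
      (μ : KeislerMeasure S M), μ.IsGenericallyStable →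
      ∃ k ≤ N, ∃ (a : Fin k → S.Elem M), 0 < k ∧
        ∀ b : Fin m → M, |μ.toFun (S.definedBy φ b) - avg a (S.definedBy φ b)| ≤ ε := by
  obtain ⟨d, hd⟩ := hT.exists_polyGrowth S φ
  obtain ⟨N, hN⟩ := exists_bounded_approximation.{max u v} d (half_pos hε)
  refine ⟨N, fun M _ _ _ μ hμ => ?_⟩
  obtain ⟨k, a, hk, ha⟩ := hμ m φ (ε / 2) (half_pos hε)
  obtain ⟨B, w, hw, hBw⟩ := exists_mass_eq_avg a
  obtain ⟨w', h1, h2, h3⟩ := hN (hd M) B w (by omega)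
  obtain ⟨a', ha'⟩ := exists_avg_eq_mass B w'
  refine ⟨_, h2, a', h1, fun b => ?_⟩
  have h4 := h3 _ ⟨b, rfl⟩
  rw [hBw, ← ha', abs_sub_comm] at h4
  have := abs_sub_le (μ.toFun (S.definedBy φ b)) (avg a (S.definedBy φ b))
    (avg a' (S.definedBy φ b))
  linarith [ha b]

open Classical in
lemma ncard_coe_inter {A : Type*} (B : Finset A) (Y : Set A) :
    ((B : Set A) ∩ Y).ncard = {x ∈ B | x ∈ Y}.card := by
  rw [← Set.ncard_coe_finset]
  congr 1
  ext x
  simp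

lemma KeislerMeasure.nontrivial_of_atomless {T : L.Theory} {S : DefSort T} {M : Type (max u v)}
    [L.Structure M] [Nonempty M] [M ⊨ T] (μ : KeislerMeasure S M)
    (h : ∀ c : S.Elem M, μ.toFun {c} = 0) : Nontrivial M := by
  by_contra hM
  rw [not_nontrivial_iff_subsingleton] at hM
  have h1 := μ.univ
  rcases isEmpty_or_nonempty (S.Elem M) with hE | ⟨⟨c⟩⟩
  · rw [Set.univ_eq_empty_iff.2 hE, μ.empty] at h1
    exact zero_ne_one h1
  · have h2 : (Set.univ : Set (S.Elem M)) = {c} := by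
      ext d
      simp [DefSort.subsingleton_elem c d]
    rw [h2, h] at h1
    exact zero_ne_one h1

open Classical in
/-- An atomless generically stable measure is approximated, on the instances of finitely many
formulas, by arbitrarily large finite sets without repetitions. Adding the equality of the sort to
the formulas shows that in a close enough approximating sequence all multiplicities are relatively
small, so that `exists_finset_approximation` applies. -/
lemma IsNIP.exists_finset_approximation_of_atomless {T : L.Theory} (hT : IsNIP T) (S : DefSort T)
    (l : List (Σ m : ℕ, L.Formula (Fin S.arity ⊕ Fin m))) {ε : ℝ} (hε : 0 < ε) (K : ℕ)
    {M : Type (max u v)} [L.Structure M] [Nonempty M] [M ⊨ T] (μ : KeislerMeasure S M)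
    (hμ : μ.IsGenericallyStable) (hμ0 : ∀ c : S.Elem M, μ.toFun {c} = 0) :
    ∃ B : Finset (S.Elem M), K ≤ B.card ∧ ∀ p ∈ l, ∀ b : Fin p.1 → M,
      |μ.toFun (S.definedBy p.2 b) - (({x ∈ B | x ∈ S.definedBy p.2 b}.card : ℕ) : ℝ) / B.card|
        ≤ ε := by
  have := μ.nontrivial_of_atomless hμ0
  obtain ⟨m, ψ, hψ⟩ := S.exists_coding (⟨S.arity, S.rel⟩ :: l)
  obtain ⟨d, hd⟩ := hT.exists_polyGrowth S ψ
  obtain ⟨δ, hδ, H⟩ := exists_finset_approximation.{max u v} d K (half_pos hε)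
  obtain ⟨k, a, hk, ha⟩ := hμ m ψ (min δ (ε / 2)) (lt_min hδ (half_pos hε))
  obtain ⟨A, w, hw, hAw⟩ := exists_mass_eq_avg a
  have hpos : 0 < mass A w Set.univ := by
    rw [mass_univ, hw]
    exact_mod_cast hk
  obtain ⟨B, hB, hB'⟩ := H (hd M) A w (by omega) (by
    intro x hx
    obtain ⟨y, rfl⟩ := S.exists_toElem x
    obtain ⟨c, hc⟩ := hψ M ⟨S.arity, S.rel⟩ (List.mem_cons_self) y.1
    have h1 := ha c
    simp only [hc, DefSort.definedBy_rel, hμ0, zero_sub, abs_neg] at h1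
    rw [← hAw] at h1
    have h2 := ((le_abs_self _).trans h1).trans (min_le_left _ _)
    rw [div_le_iff₀ hpos] at h2
    refine le_trans (le_of_eq ?_) h2
    rw [mass, Finset.sum_filter]
    simp [hx])
  refine ⟨B, hB, fun p hp b => ?_⟩
  obtain ⟨c, hc⟩ := hψ M p (List.mem_cons_of_mem _ hp) b
  rw [← hc]
  have h1 := hB' _ ⟨c, rfl⟩
  rw [hAw, abs_sub_comm] at h1
  have h2 := (ha c).trans (min_le_right _ _)
  refine (abs_sub_le _ (avg a (S.definedBy ψ c)) _).trans ?_
  linarith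

/-- A cut of the part of an approximating finite set inside `φ(x; a)`, in the ratio
`r / μ(φ(x; a))`, is a cut of the measure. If `μ(φ(x; a)) ≤ ε` there is nothing to do, and otherwise
this part is large enough for the hypothesis to apply. -/
theorem IsNIP.cutsMeasures_of_cutsFiniteSets {T : L.Theory} (hT : IsNIP T) {S : DefSort T}
    (h : UniformlyCutsFiniteSets S) : UniformlyCutsGenericallyStableMeasures S := by
  classical
  intro k φ ε hε
  obtain ⟨m, χ, K, hK⟩ := h (ε / 4) (by linarith)
  refine ⟨m, χ, fun M _ _ _ μ hμ hμ0 a r hr0 hr => ?_⟩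
  set p := μ.toFun (S.definedBy φ a) with hp
  have hφ := S.isDefinable_definedBy φ a
  by_cases hpε : p ≤ ε
  · obtain ⟨e⟩ := ‹Nonempty M›
    refine ⟨fun _ => e, ?_⟩
    have h1 := μ.nonneg' (S.definedBy φ a ∩ S.definedBy χ fun _ => e)
    have h2 := μ.mono (hφ.inter (S.isDefinable_definedBy χ fun _ => e)) hφ Set.inter_subset_left
    rw [abs_le]
    constructor <;> linarith
  have hp0 : 0 < p := by linarith
  obtain ⟨B, hB, hBφ⟩ := hT.exists_finset_approximation_of_atomless S
    [⟨_, φ⟩, ⟨_, S.interFormula φ χ⟩] (show 0 < ε / 4 by linarith)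
    (⌈K / (ε / 2)⌉₊ + 1) μ hμ hμ0
  have hB' : K / (ε / 2) + 1 ≤ (B.card : ℝ) := by
    have h1 : ((⌈K / (ε / 2)⌉₊ + 1 : ℕ) : ℝ) ≤ B.card := by exact_mod_cast hB
    push_cast at h1
    linarith [Nat.le_ceil (K / (ε / 2))]
  have hBpos : (0 : ℝ) < B.card := by
    have : 0 ≤ K / (ε / 2) := by positivity
    linarith
  set A : Finset (S.Elem M) := {x ∈ B | x ∈ S.definedBy φ a} with hA
  have h1 : |p - A.card / B.card| ≤ ε / 4 := hBφ ⟨_, φ⟩ (by simp) a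
  obtain ⟨h1l, h1r⟩ := abs_le.1 h1
  have hAcard : (K : ℝ) ≤ A.card := by
    have h2 : ε / 2 ≤ A.card / B.card := by linarith
    rw [le_div_iff₀ hBpos] at h2
    have h3 : K / (ε / 2) ≤ (B.card : ℝ) := by linarith
    rw [div_le_iff₀ (by linarith)] at h3
    linarith
  have hApos : (0 : ℝ) < A.card := by
    have h2 : 0 < (A.card : ℝ) / B.card := by linarith
    exact (div_pos_iff_of_pos_right hBpos).1 h2
  obtain ⟨b, hb⟩ := hK M A (by exact_mod_cast hAcard) (r / p) (by positivity)
    (div_le_one_of_le₀ hr hp0.le)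
  refine ⟨b, ?_⟩
  have h2 := hBφ ⟨_, S.interFormula φ χ⟩ (by simp) (Fin.append a b)
  simp only [S.definedBy_inter] at h2
  have h3 : ({x ∈ B | x ∈ S.definedBy φ a ∩ S.definedBy χ b}.card : ℝ) =
      ((A : Set (S.Elem M)) ∩ S.definedBy χ b).ncard := by
    rw [ncard_coe_inter, hA, Finset.filter_filter]
    rfl
  rw [h3] at h2
  set n : ℝ := (((A : Set (S.Elem M)) ∩ S.definedBy χ b).ncard : ℝ)
  set q : ℝ := A.card / B.card with hq
  have hq1 : q ≤ 1 := by
    rw [hq]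
    refine div_le_one_of_le₀ ?_ hBpos.le
    exact_mod_cast Finset.card_filter_le _ _
  have hq0 : 0 ≤ q := by positivity
  have h4 : |n / B.card - q * (r / p)| ≤ ε / 4 := by
    have h5 : n / B.card - q * (r / p) = q * (n / A.card - r / p) := by
      rw [hq]
      field_simp
    rw [h5, abs_mul, abs_of_nonneg hq0]
    calc _ ≤ 1 * (ε / 4) := by gcongr
      _ = _ := one_mul _
  have h6 : |q * (r / p) - r| ≤ ε / 4 := by
    have h5 : q * (r / p) - r = (r / p) * (q - p) := by field_simp
    rw [h5, abs_mul, abs_of_nonneg (by positivity), abs_sub_comm]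
    calc _ ≤ 1 * (ε / 4) := by
          gcongr
          exact div_le_one_of_le₀ hr hp0.le
      _ = _ := one_mul _
  obtain ⟨_, _⟩ := abs_le.1 h2
  obtain ⟨_, _⟩ := abs_le.1 h4
  obtain ⟨_, _⟩ := abs_le.1 h6
  rw [abs_le]
  constructor <;> linarith

lemma TypeOver.toMeasure_eq_zero_or_one {T : L.Theory} {S : DefSort T} {M : Type (max u v)}
    [L.Structure M] [Nonempty M] [M ⊨ T] (p : TypeOver S M) (X : Set (S.Elem M)) :
    p.toMeasure.toFun X = 0 ∨ p.toMeasure.toFun X = 1 := by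
  unfold TypeOver.toMeasure
  dsimp only
  split_ifs <;> simp

lemma TypeOver.toMeasure_of_mem {T : L.Theory} {S : DefSort T} {M : Type (max u v)}
    [L.Structure M] [Nonempty M] [M ⊨ T] (p : TypeOver S M) {X : Set (S.Elem M)}
    (h : X ∈ p.sets) : p.toMeasure.toFun X = 1 := if_pos h

lemma TypeOver.toMeasure_of_notMem {T : L.Theory} {S : DefSort T} {M : Type (max u v)}
    [L.Structure M] [Nonempty M] [M ⊨ T] (p : TypeOver S M) {X : Set (S.Elem M)}
    (h : X ∉ p.sets) : p.toMeasure.toFun X = 0 := if_neg h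

lemma TypeOver.isRealized_iff {T : L.Theory} {S : DefSort T} {M : Type (max u v)}
    [L.Structure M] [Nonempty M] [M ⊨ T] (p : TypeOver S M) :
    p.IsRealized ↔ ∃ c : S.Elem M, {c} ∈ p.sets := by
  constructor
  · rintro ⟨c, hc⟩
    exact ⟨c, (hc _ (DefSort.isDefinable_singleton c)).2 rfl⟩
  · rintro ⟨c, hc⟩
    refine ⟨c, fun X hX => ⟨fun h => ?_, fun h => p.superset_mem _ hc X hX (by simpa using h)⟩⟩
    by_contra hcX
    have h1 := p.superset_mem _ hc _ hX.compl (by simpa using hcX)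
    exact (p.compl_mem_iff X hX).1 h1 h

lemma TypeOver.atomless_of_not_isRealized {T : L.Theory} {S : DefSort T} {M : Type (max u v)}
    [L.Structure M] [Nonempty M] [M ⊨ T] (p : TypeOver S M) (hp : ¬ p.IsRealized)
    (c : S.Elem M) : p.toMeasure.toFun {c} = 0 :=
  p.toMeasure_of_notMem fun h => hp (p.isRealized_iff.2 ⟨c, h⟩)

lemma DefSort.definedBy_top {T : L.Theory} (S : DefSort T) {M : Type (max u v)}
    [L.Structure M] [Nonempty M] [M ⊨ T] {m : ℕ} (b : Fin m → M) :
    S.definedBy ⊤ b = Set.univ := by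
  ext s
  obtain ⟨x, rfl⟩ := S.exists_toElem s
  simp only [Set.mem_univ, iff_true]
  exact ⟨x, rfl, Language.Formula.realize_top.2 trivial⟩

theorem typesRealized_of_cutsMeasures {T : L.Theory} {S : DefSort T}
    (h : UniformlyCutsGenericallyStableMeasures S) : GenericallyStableTypesRealized S := by
  intro M _ _ _ p hp
  by_contra hr
  obtain ⟨m, χ, hχ⟩ := h 0 ⊤ (1 / 4) (by norm_num)
  obtain ⟨b, hb⟩ := hχ M p.toMeasure hp (p.atomless_of_not_isRealized hr) Fin.elim0 (1 / 2)
    (by norm_num) (by rw [S.definedBy_top, p.toMeasure.univ]; norm_num)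
  rcases p.toMeasure_eq_zero_or_one (S.definedBy ⊤ Fin.elim0 ∩ S.definedBy χ b) with h | h <;>
    rw [h] at hb <;> norm_num [abs_le] at hb

/-! ### Ultraproducts of Keisler measures -/

section Weighted

variable {T : L.Theory} {S : DefSort T} {M : Type (max u v)} [L.Structure M] [Nonempty M] [M ⊨ T]

lemma KeislerMeasure.nonempty_elem (μ : KeislerMeasure S M) : Nonempty (S.Elem M) := by
  by_contra h
  rw [not_nonempty_iff] at h
  have := μ.univ
  rw [Set.univ_eq_empty_iff.2 h, μ.empty] at this
  exact zero_ne_one this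

open Classical in
/-- The measure `∑ c i • δ (e i)` with finite support. -/
noncomputable def weightedMeasure {ι : Type*} [Fintype ι] (e : ι → S.Elem M) (c : ι → ℝ)
    (hc : ∀ i, 0 ≤ c i) (hc1 : ∑ i, c i = 1) : KeislerMeasure S M where
  toFun X := if S.IsDefinable X then ∑ i, (if e i ∈ X then c i else 0) else 0
  not_definable X hX := if_neg hX
  nonneg X hX := by
    rw [if_pos hX]
    exact Finset.sum_nonneg fun i _ => by split_ifs <;> simp [hc]
  univ := by simp [DefSort.isDefinable_univ, hc1]
  union X Y hX hY hXY := by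
    rw [if_pos (hX.union S hY), if_pos hX, if_pos hY, ← Finset.sum_add_distrib]
    refine Finset.sum_congr rfl fun i _ => ?_
    by_cases h : e i ∈ X
    · simp [h, Set.disjoint_left.1 hXY h]
    · simp [h]

open Classical in
lemma weightedMeasure_apply {ι : Type*} [Fintype ι] (e : ι → S.Elem M) (c : ι → ℝ)
    (hc : ∀ i, 0 ≤ c i) (hc1 : ∑ i, c i = 1) {X : Set (S.Elem M)} (hX : S.IsDefinable X) :
    (weightedMeasure e c hc hc1).toFun X = ∑ i, if e i ∈ X then c i else 0 := if_pos hX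

/-- The frequency measure of a finite sequence. -/
noncomputable def avgMeasure {k : ℕ} (hk : 0 < k) (a : Fin k → S.Elem M) : KeislerMeasure S M :=
  weightedMeasure a (fun _ => 1 / k) (fun _ => by positivity) (by simp [hk.ne'])

lemma avgMeasure_apply {k : ℕ} (hk : 0 < k) (a : Fin k → S.Elem M) {X : Set (S.Elem M)}
    (hX : S.IsDefinable X) : (avgMeasure hk a).toFun X = avg a X := by
  classical
  rw [avgMeasure, weightedMeasure_apply _ _ _ _ hX, avg_eq_sum]

lemma avgMeasure_isGenericallyStable {k : ℕ} (hk : 0 < k) (a : Fin k → S.Elem M) :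
    (avgMeasure hk a).IsGenericallyStable := fun m φ ε hε =>
  ⟨k, a, hk, fun b => by
    rw [avgMeasure_apply hk a (S.isDefinable_definedBy φ b)]
    simpa using hε.le⟩

end Weighted

open Filter

section Sections

universe w

variable {I : Type w} (U : Ultrafilter I) {M : I → Type w}

/-- By choice of a section of counterexamples, a property that holds eventually along every section
holds eventually for all elements. -/
lemma eventually_forall_of_section {A : I → Type*} [∀ i, Nonempty (A i)] {Q : ∀ i, A i → Prop}
    (h : ∀ s : ∀ i, A i, ∀ᶠ i in U, Q i (s i)) : ∀ᶠ i in U, ∀ x, Q i x := by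
  refine (h fun i => Classical.epsilon fun x => ¬ Q i x).mono fun i hi x => ?_
  by_contra hx
  exact Classical.epsilon_spec (p := fun x => ¬ Q i x) ⟨x, hx⟩ hi

lemma tendsto_limUnder_of_mem_Icc {f : I → ℝ} (hf : ∀ i, f i ∈ Set.Icc (0 : ℝ) 1) :
    Tendsto f U (nhds (limUnder (U : Filter I) f)) := by
  have h1 : (U.map f : Filter ℝ) ≤ 𝓟 (Set.Icc 0 1) := by
    rw [le_principal_iff]
    change ∀ᶠ i in (U : Filter I), f i ∈ Set.Icc (0 : ℝ) 1
    exact Eventually.of_forall hf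
  obtain ⟨x, -, hx⟩ := isCompact_Icc.ultrafilter_le_nhds (U.map f) h1
  exact tendsto_nhds_limUnder ⟨x, hx⟩

/-- The tuple of elements of the ultraproduct represented by a tuple of sections. -/
def castTuple {m : ℕ} (b : Fin m → ∀ i, M i) : Fin m → (U : Filter I).Product M :=
  fun j => (b j : (U : Filter I).Product M)

lemma exists_castTuple {m : ℕ} (b : Fin m → (U : Filter I).Product M) :
    ∃ b', castTuple U b' = b := by
  choose b' hb' using fun j => Quotient.exists_rep (b j)
  exact ⟨b', funext hb'⟩

lemma castTuple_sumElim_realize {n m : ℕ} [∀ i, L.Structure (M i)] [∀ i, Nonempty (M i)]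
    (φ : L.Formula (Fin n ⊕ Fin m)) (x : Fin n → ∀ i, M i)
    (b : Fin m → ∀ i, M i) :
    φ.Realize (Sum.elim (castTuple U x) (castTuple U b)) ↔
      ∀ᶠ i in U, φ.Realize (Sum.elim (fun j => x j i) fun j => b j i) := by
  have h1 : Sum.elim (castTuple U x) (castTuple U b) =
      fun j => ((Sum.elim x b j : ∀ i, M i) : (U : Filter I).Product M) := by
    ext j; rcases j <;> rfl
  refine (iff_of_eq (congrArg φ.Realize h1)).trans
    ((Language.Ultraproduct.realize_formula_cast φ (Sum.elim x b)).trans ?_)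
  refine eventually_congr (Eventually.of_forall fun i => ?_)
  have h2 : (fun j => Sum.elim x b j i) = Sum.elim (fun j => x j i) fun j => b j i := by
    ext j; rcases j <;> rfl
  rw [h2]

lemma castTuple_realize {n : ℕ} [∀ i, L.Structure (M i)] [∀ i, Nonempty (M i)]
    (φ : L.Formula (Fin n)) (x : Fin n → ∀ i, M i) :
    φ.Realize (castTuple U x) ↔ ∀ᶠ i in U, φ.Realize fun j => x j i :=
  Language.Ultraproduct.realize_formula_cast φ x

lemma castTuple_eq_of_eventually {n : ℕ} {x y : Fin n → ∀ i, M i}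
    (h : ∀ᶠ i in U, ∀ j, x j i = y j i) : castTuple U x = castTuple U y :=
  funext fun j => Quotient.sound (h.mono fun _ hi => hi j)

end Sections

section Ultraproduct

variable {T : L.Theory} {S : DefSort T} {I : Type (max u v)} (U : Ultrafilter I)
  {M : I → Type (max u v)} [∀ i, L.Structure (M i)] [∀ i, Nonempty (M i)] [∀ i, M i ⊨ T]

instance ultraproduct_models : (U : Filter I).Product M ⊨ T where
  realize_of_mem φ hφ := (Language.Ultraproduct.sentence_realize φ).2
    (Eventually.of_forall fun i => Language.Theory.realize_sentence_of_mem (M := M i) T hφ)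

/-- The representative of an element of the sort in the ultraproduct given by a section of
representatives. -/
def castRep (x : ∀ i, S.Rep (M i)) : S.Rep ((U : Filter I).Product M) :=
  ⟨castTuple U fun j i => (x i).1 j,
    (castTuple_realize U S.dom _).2 (Eventually.of_forall fun i => (x i).2)⟩

/-- The element of the sort in the ultraproduct represented by a section of elements. -/
noncomputable def castElem (s : ∀ i, S.Elem (M i)) : S.Elem ((U : Filter I).Product M) :=
  S.toElem (castRep U fun i => (S.exists_toElem (s i)).choose)

lemma castElem_toElem (x : ∀ i, S.Rep (M i)) :
    castElem U (fun i => S.toElem (x i)) = S.toElem (castRep U x) := by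
  rw [castElem, DefSort.toElem_eq_iff]
  refine (castTuple_sumElim_realize U _ _ _).2 (Eventually.of_forall fun i => ?_)
  rw [← DefSort.toElem_eq_iff]
  exact (S.exists_toElem (S.toElem (x i))).choose_spec

lemma castElem_eq_iff (s t : ∀ i, S.Elem (M i)) :
    castElem U s = castElem U t ↔ ∀ᶠ i in U, s i = t i := by
  choose x hx using fun i => S.exists_toElem (s i)
  choose y hy using fun i => S.exists_toElem (t i)
  obtain rfl : (fun i => S.toElem (x i)) = s := funext hx
  obtain rfl : (fun i => S.toElem (y i)) = t := funext hy
  rw [castElem_toElem, castElem_toElem, DefSort.toElem_eq_iff]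
  refine (castTuple_sumElim_realize U _ _ _).trans
    (eventually_congr (Eventually.of_forall fun i => ?_))
  rw [← DefSort.toElem_eq_iff]

lemma castElem_mem_definedBy_iff {m : ℕ} (φ : L.Formula (Fin S.arity ⊕ Fin m))
    (s : ∀ i, S.Elem (M i)) (b : Fin m → ∀ i, M i) :
    castElem U s ∈ S.definedBy φ (castTuple U b) ↔
      ∀ᶠ i in U, s i ∈ S.definedBy φ fun j => b j i := by
  choose x hx using fun i => S.exists_toElem (s i)
  obtain rfl : (fun i => S.toElem (x i)) = s := funext hx
  rw [castElem_toElem, ← DefSort.realize_saturate]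
  refine (castTuple_sumElim_realize U _ _ _).trans
    (eventually_congr (Eventually.of_forall fun i => ?_))
  rw [← DefSort.realize_saturate]

lemma exists_castElem [∀ i, Nonempty (S.Elem (M i))] (s : S.Elem ((U : Filter I).Product M)) :
    ∃ s', castElem U s' = s := by
  classical
  obtain ⟨x, rfl⟩ := S.exists_toElem s
  obtain ⟨y, hy⟩ := exists_castTuple U x.1
  have hdom : ∀ᶠ i in U, S.dom.Realize fun j => y j i := by
    rw [← castTuple_realize, hy]
    exact x.2
  have hne : ∀ i, Nonempty (S.Rep (M i)) := fun i =>
    ⟨(S.exists_toElem (Classical.arbitrary (S.Elem (M i)))).choose⟩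
  have hr : ∀ i, ∃ r : S.Rep (M i), (S.dom.Realize fun j => y j i) → r.1 = fun j => y j i := by
    intro i
    by_cases h : S.dom.Realize fun j => y j i
    · exact ⟨⟨_, h⟩, fun _ => rfl⟩
    · exact ⟨Classical.arbitrary _, fun h' => absurd h' h⟩
  choose r hr using hr
  refine ⟨fun i => S.toElem (r i), ?_⟩
  rw [castElem_toElem]
  congr 1
  refine Subtype.ext ?_
  rw [← hy]
  exact castTuple_eq_of_eventually U (hdom.mono fun i hi j => congrFun (hr i hi) j)

/-- The subset `X` of the sort in the ultraproduct is the ultraproduct of the sets `X' i`. -/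
def Represents (X' : ∀ i, Set (S.Elem (M i))) (X : Set (S.Elem ((U : Filter I).Product M))) :
    Prop :=
  ∀ s, castElem U s ∈ X ↔ ∀ᶠ i in U, s i ∈ X' i

lemma represents_definedBy {m : ℕ} (φ : L.Formula (Fin S.arity ⊕ Fin m)) (b : Fin m → ∀ i, M i) :
    Represents U (fun i => S.definedBy φ fun j => b j i) (S.definedBy φ (castTuple U b)) :=
  fun s => castElem_mem_definedBy_iff U φ s b

lemma represents_singleton [∀ i, Nonempty (S.Elem (M i))] (c : ∀ i, S.Elem (M i)) :
    Represents U (fun i => {c i}) {castElem U c} := fun s => by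
  simp [castElem_eq_iff]

variable {U}

lemma Represents.union {X' Y' : ∀ i, Set (S.Elem (M i))}
    {X Y : Set (S.Elem ((U : Filter I).Product M))} (hX : Represents U X' X)
    (hY : Represents U Y' Y) : Represents U (fun i => X' i ∪ Y' i) (X ∪ Y) := fun s => by
  simp only [Set.mem_union, hX s, hY s, Ultrafilter.eventually_or]

lemma Represents.inter {X' Y' : ∀ i, Set (S.Elem (M i))}
    {X Y : Set (S.Elem ((U : Filter I).Product M))} (hX : Represents U X' X)
    (hY : Represents U Y' Y) : Represents U (fun i => X' i ∩ Y' i) (X ∩ Y) := fun s => by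
  simp only [Set.mem_inter_iff, hX s, hY s, eventually_and]

lemma Represents.eventually_subset [∀ i, Nonempty (S.Elem (M i))] {X' Y' : ∀ i, Set (S.Elem (M i))}
    {X Y : Set (S.Elem ((U : Filter I).Product M))} (hX : Represents U X' X)
    (hY : Represents U Y' Y) (h : X ⊆ Y) : ∀ᶠ i in U, X' i ⊆ Y' i := by
  refine eventually_forall_of_section U fun s => ?_
  rw [Ultrafilter.eventually_imp, ← hX s, ← hY s]
  exact @h _

lemma Represents.eventually_eq [∀ i, Nonempty (S.Elem (M i))] {X' Y' : ∀ i, Set (S.Elem (M i))}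
    {X : Set (S.Elem ((U : Filter I).Product M))} (hX : Represents U X' X)
    (hY : Represents U Y' X) : ∀ᶠ i in U, X' i = Y' i := by
  filter_upwards [hX.eventually_subset hY subset_rfl, hY.eventually_subset hX subset_rfl]
    with i h1 h2
  exact h1.antisymm h2

lemma Represents.eventually_disjoint [∀ i, Nonempty (S.Elem (M i))]
    {X' Y' : ∀ i, Set (S.Elem (M i))} {X Y : Set (S.Elem ((U : Filter I).Product M))}
    (hX : Represents U X' X) (hY : Represents U Y' Y) (h : Disjoint X Y) :
    ∀ᶠ i in U, Disjoint (X' i) (Y' i) := by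
  have h1 : Represents U (fun i => (∅ : Set (S.Elem (M i)))) ∅ := fun s => by
    simp [U.neBot.ne]
  refine ((hX.inter hY).eventually_subset h1 (Set.disjoint_iff.1 h)).mono fun i hi => ?_
  exact Set.disjoint_iff.2 hi

variable (U)

lemma exists_represents {X : Set (S.Elem ((U : Filter I).Product M))} (hX : S.IsDefinable X) :
    ∃ X' : ∀ i, Set (S.Elem (M i)), (∀ i, S.IsDefinable (X' i)) ∧ Represents U X' X := by
  obtain ⟨m, φ, b, rfl⟩ := DefSort.isDefinable_iff S |>.1 hX
  obtain ⟨b, rfl⟩ := exists_castTuple U b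
  exact ⟨_, fun i => S.isDefinable_definedBy φ _, represents_definedBy U φ b⟩

open Classical in
/-- The value at `X` of the ultraproduct of the measures `μ i`, before its properties are known. -/
noncomputable def ultraMeasureFun (μ : ∀ i, KeislerMeasure S (M i))
    (X : Set (S.Elem ((U : Filter I).Product M))) : ℝ :=
  if hX : S.IsDefinable X then
    limUnder (U : Filter I) fun i => (μ i).toFun ((exists_represents U hX).choose i) else 0

lemma tendsto_ultraMeasureFun (μ : ∀ i, KeislerMeasure S (M i))
    {X' : ∀ i, Set (S.Elem (M i))} {X : Set (S.Elem ((U : Filter I).Product M))}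
    (hX : S.IsDefinable X) (h : Represents U X' X) :
    Tendsto (fun i => (μ i).toFun (X' i)) U (nhds (ultraMeasureFun U μ X)) := by
  have := fun i => (μ i).nonempty_elem
  rw [ultraMeasureFun, dif_pos hX]
  refine (tendsto_limUnder_of_mem_Icc U fun i => ⟨(μ i).nonneg' _, (μ i).le_one _⟩).congr' ?_
  filter_upwards [(exists_represents U hX).choose_spec.2.eventually_eq h] with i hi
  rw [hi]

/-- The ultraproduct of Keisler measures: the ultraproduct of definable sets `X i` gets the
ultralimit of the values `μ i (X i)`. -/
noncomputable def ultraMeasure (μ : ∀ i, KeislerMeasure S (M i)) :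
    KeislerMeasure S ((U : Filter I).Product M) where
  toFun := ultraMeasureFun U μ
  not_definable X hX := dif_neg hX
  nonneg X hX := by
    obtain ⟨X', -, h⟩ := exists_represents U hX
    exact ge_of_tendsto (tendsto_ultraMeasureFun U μ hX h)
      (Eventually.of_forall fun i => (μ i).nonneg' _)
  univ := by
    have h1 : Represents U (fun i => (Set.univ : Set (S.Elem (M i)))) Set.univ := fun s => by simp
    refine tendsto_nhds_unique (tendsto_ultraMeasureFun U μ DefSort.isDefinable_univ h1) ?_
    simp only [KeislerMeasure.univ]
    exact tendsto_const_nhds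
  union X Y hX hY hXY := by
    have := fun i => (μ i).nonempty_elem
    obtain ⟨X', hX', h1⟩ := exists_represents U hX
    obtain ⟨Y', hY', h2⟩ := exists_represents U hY
    refine tendsto_nhds_unique (tendsto_ultraMeasureFun U μ (hX.union S hY) (h1.union h2)) ?_
    refine ((tendsto_ultraMeasureFun U μ hX h1).add
      (tendsto_ultraMeasureFun U μ hY h2)).congr' ?_
    filter_upwards [h1.eventually_disjoint h2 hXY] with i hi
    rw [(μ i).union _ _ (hX' i) (hY' i) hi]

lemma tendsto_ultraMeasure (μ : ∀ i, KeislerMeasure S (M i))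
    {X' : ∀ i, Set (S.Elem (M i))} {X : Set (S.Elem ((U : Filter I).Product M))}
    (hX : S.IsDefinable X) (h : Represents U X' X) :
    Tendsto (fun i => (μ i).toFun (X' i)) U (nhds ((ultraMeasure U μ).toFun X)) :=
  tendsto_ultraMeasureFun U μ hX h

lemma tendsto_ultraMeasure_definedBy (μ : ∀ i, KeislerMeasure S (M i)) {m : ℕ}
    (φ : L.Formula (Fin S.arity ⊕ Fin m)) (b : Fin m → ∀ i, M i) :
    Tendsto (fun i => (μ i).toFun (S.definedBy φ fun j => b j i)) U
      (nhds ((ultraMeasure U μ).toFun (S.definedBy φ (castTuple U b)))) :=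
  tendsto_ultraMeasure U μ (S.isDefinable_definedBy _ _) (represents_definedBy U φ b)

lemma ultraMeasure_atomless (μ : ∀ i, KeislerMeasure S (M i))
    (h : ∀ c : ∀ i, S.Elem (M i), Tendsto (fun i => (μ i).toFun {c i}) U (nhds 0))
    (c : S.Elem ((U : Filter I).Product M)) : (ultraMeasure U μ).toFun {c} = 0 := by
  have := fun i => (μ i).nonempty_elem
  obtain ⟨c, rfl⟩ := exists_castElem U c
  exact tendsto_nhds_unique (tendsto_ultraMeasure U μ (DefSort.isDefinable_singleton _)
    (represents_singleton U c)) (h c)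

/-- In a NIP theory, an ultraproduct of generically stable measures is generically stable, since
the size of the approximating sequences can be bounded in advance. -/
lemma IsNIP.ultraMeasure_isGenericallyStable (hT : IsNIP T) {μ : ∀ i, KeislerMeasure S (M i)}
    (hμ : ∀ i, (μ i).IsGenericallyStable) : (ultraMeasure U μ).IsGenericallyStable := by
  intro m φ ε hε
  obtain ⟨N, hN⟩ := hT.exists_uniform_approximation S φ hε
  choose k hkN a hk ha using fun i => hN (M i) (μ i) (hμ i)
  obtain ⟨n, -, hn⟩ : ∃ n ∈ Set.Iic N, ∀ᶠ i in U, k i = n := by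
    have h1 : ∀ᶠ i in U, ∃ n ∈ Set.Iic N, k i = n :=
      Eventually.of_forall fun i => ⟨k i, hkN i, rfl⟩
    exact (Ultrafilter.eventually_exists_mem_iff (Set.finite_Iic N)).1 h1
  have hne := fun i => (μ i).nonempty_elem
  set a' : Fin n → ∀ i, S.Elem (M i) := fun j i =>
    if h : k i = n then a i (Fin.cast h.symm j) else Classical.arbitrary _ with ha'
  refine ⟨n, fun j => castElem U (a' j), ?_, fun b => ?_⟩
  · obtain ⟨i, hi⟩ := hn.exists
    exact hi ▸ hk i
  obtain ⟨b, rfl⟩ := exists_castTuple U b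
  have h1 : ∀ᶠ i in U, ∀ j, (castElem U (a' j) ∈ S.definedBy φ (castTuple U b) ↔
      a' j i ∈ S.definedBy φ fun l => b l i) := by
    rw [eventually_all]
    intro j
    by_cases h : castElem U (a' j) ∈ S.definedBy φ (castTuple U b)
    · exact ((castElem_mem_definedBy_iff U φ _ b).1 h).mono fun i hi => ⟨fun _ => hi, fun _ => h⟩
    · have h2 := h
      rw [castElem_mem_definedBy_iff, ← Ultrafilter.eventually_not] at h2
      exact h2.mono fun i hi => ⟨fun h' => absurd h' h, fun h' => absurd h' hi⟩
  have h2 := ((tendsto_ultraMeasure_definedBy U μ φ b).sub_const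
    (avg (fun j => castElem U (a' j)) (S.definedBy φ (castTuple U b)))).abs
  refine le_of_tendsto h2 ?_
  filter_upwards [h1, hn] with i hi hni
  subst hni
  have h3 : avg (fun j => castElem U (a' j)) (S.definedBy φ (castTuple U b)) =
      avg (a i) (S.definedBy φ fun l => b l i) := by
    unfold avg
    congr 3
    ext j
    have := hi j
    simp only [ha', dif_pos] at this
    exact this
  rw [h3]
  exact ha i _

end Ultraproduct

/-! ### Atoms of generically stable measures -/

section Atom

variable {T : L.Theory} {S : DefSort T} {M : Type (max u v)} [L.Structure M] [Nonempty M] [M ⊨ T]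

/-- The complete type given by an ultrafilter on the set of all elements of the sort. -/
def TypeOver.ofUltrafilter (W : Ultrafilter (S.Elem M)) : TypeOver S M where
  sets := {X | S.IsDefinable X ∧ X ∈ W}
  definable _ hX := hX.1
  univ_mem := ⟨DefSort.isDefinable_univ, Filter.univ_mem⟩
  inter_mem _ hX _ hY := ⟨hX.1.inter hY.1, Filter.inter_mem hX.2 hY.2⟩
  superset_mem _ hX _ hY h := ⟨hY, mem_of_superset hX.2 h⟩
  compl_mem_iff X hX := by
    simp [hX, hX.compl, Ultrafilter.compl_mem_iff_notMem]

/-- If `μ` takes no value near `r` on definable sets, then the space is not covered by finitely many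
definable sets of small measure: in the increasing sequence of partial unions, the measure would
have to jump over the gap around `r`. Hence some ultrafilter avoids all these sets. -/
lemma KeislerMeasure.exists_ultrafilter_of_gap (μ : KeislerMeasure S M) {r ε : ℝ} (hε : 0 < ε)
    (hr0 : 0 ≤ r) (hr1 : r ≤ 1)
    (h : ∀ Z : Set (S.Elem M), S.IsDefinable Z → ε ≤ |μ.toFun Z - r|) :
    ∃ W : Ultrafilter (S.Elem M), ∀ X, S.IsDefinable X → X ∈ W → ε ≤ μ.toFun X := by
  set G : Set (Set (S.Elem M)) := {X | S.IsDefinable X ∧ μ.toFun Xᶜ < ε} with hG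
  have key : ∀ t : Set (Set (S.Elem M)), t.Finite → t ⊆ G →
      S.IsDefinable (⋂₀ t)ᶜ ∧ μ.toFun (⋂₀ t)ᶜ ≤ r - ε := by
    intro t ht
    induction t, ht using Set.Finite.induction_on with
    | empty =>
      intro _
      have h1 := h ∅ DefSort.isDefinable_empty
      rw [μ.empty, zero_sub, abs_neg, abs_of_nonneg hr0] at h1
      simp only [Set.sInter_empty, Set.compl_univ, μ.empty]
      exact ⟨DefSort.isDefinable_empty, by linarith⟩
    | @insert X t _ _ ih =>
      intro hXt
      obtain ⟨h1, h2⟩ := ih ((Set.subset_insert _ _).trans hXt)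
      obtain ⟨h3, h4⟩ := hXt (Set.mem_insert _ _)
      rw [Set.sInter_insert, Set.compl_inter]
      refine ⟨h3.compl.union S h1, ?_⟩
      have h5 := μ.union_le h3.compl h1
      have h6 := h _ (h3.compl.union S h1)
      rcases abs_cases (μ.toFun (Xᶜ ∪ (⋂₀ t)ᶜ) - r) with ⟨h7, _⟩ | ⟨h7, _⟩ <;>
        rw [h7] at h6 <;> linarith
  have hne : NeBot (generate G) := by
    rw [generate_neBot_iff]
    intro t htG ht
    by_contra hempty
    rw [Set.not_nonempty_iff_eq_empty] at hempty
    have h1 := (key t ht htG).2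
    rw [hempty, Set.compl_empty, μ.univ] at h1
    linarith
  refine ⟨Ultrafilter.of (generate G), fun X hX hXW => ?_⟩
  by_contra hlt
  have h1 : Xᶜ ∈ generate G :=
    mem_generate_of_mem ⟨hX.compl, by rw [compl_compl]; exact not_le.1 hlt⟩
  exact (Ultrafilter.compl_mem_iff_notMem.1 (Ultrafilter.of_le _ h1)) hXW

/-- The part of a sequence inside `X` computes the normalized restriction to `X`. -/
lemma exists_avg_restrict {A : Type*} {k : ℕ} (a : Fin k → A) (X : Set A)
    (hX : ∃ i, a i ∈ X) :
    ∃ (n : ℕ) (a' : Fin n → A), 0 < n ∧ ∀ Y, avg a' Y = avg a (X ∩ Y) / avg a X := by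
  classical
  obtain ⟨i₀, hi₀⟩ := hX
  let e : {i // a i ∈ X} ≃ Fin _ := Fintype.equivFin {i // a i ∈ X}
  have hcard : {i | a i ∈ X}.ncard = Fintype.card {i // a i ∈ X} := by
    rw [← Nat.card_coe_set_eq, Nat.card_eq_fintype_card]
    rfl
  have hk : (k : ℝ) ≠ 0 := by
    have := i₀.pos
    positivity
  refine ⟨_, fun j => a (e.symm j), Fintype.card_pos_iff.2 ⟨⟨i₀, hi₀⟩⟩, fun Y => ?_⟩
  rw [avg, avg, avg, div_div_div_cancel_right₀ hk, hcard]
  congr 2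
  have h1 : {i | a i ∈ X ∩ Y} = (fun j => (e.symm j : Fin k)) '' {j | a (e.symm j) ∈ Y} := by
    ext i
    constructor
    · rintro ⟨h1, h2⟩
      exact ⟨e ⟨i, h1⟩, by simpa using h2, by simp⟩
    · rintro ⟨j, hj, rfl⟩
      exact ⟨(e.symm j).2, hj⟩
  rw [h1]
  exact (Set.ncard_image_of_injective _ (Subtype.val_injective.comp e.symm.injective)).symm

/-- An atom of a generically stable measure is a generically stable type: it is the uniform limit
of the normalized restrictions of the measure to members `X` of the type whose measure tends to
its infimum. -/
lemma KeislerMeasure.IsGenericallyStable.of_atom {μ : KeislerMeasure S M}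
    (hμ : μ.IsGenericallyStable) (hM : Nontrivial M) (p : TypeOver S M) {ε : ℝ} (hε : 0 < ε)
    (hp : ∀ X ∈ p.sets, ε ≤ μ.toFun X) : p.IsGenericallyStable := by
  classical
  intro m φ η hη
  set α := sInf (μ.toFun '' p.sets) with hα
  have hbdd : BddBelow (μ.toFun '' p.sets) := ⟨ε, by
    rintro _ ⟨X, hX, rfl⟩
    exact hp X hX⟩
  have hαle : ∀ X ∈ p.sets, α ≤ μ.toFun X := fun X hX => csInf_le hbdd ⟨X, hX, rfl⟩
  set δ := min (η * ε / 6) (ε / 2) with hδ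
  have hδ0 : 0 < δ := lt_min (by positivity) (by positivity)
  have hδ1 : δ ≤ η * ε / 6 := min_le_left _ _
  have hδ2 : δ ≤ ε / 2 := min_le_right _ _
  obtain ⟨_, ⟨X, hX, rfl⟩, hXα⟩ := exists_lt_of_csInf_lt
    (⟨_, Set.univ, p.univ_mem, rfl⟩ : (μ.toFun '' p.sets).Nonempty) (show α < α + δ by linarith)
  have hXdef := p.definable X hX
  obtain ⟨m', θ, c, rfl⟩ := (DefSort.isDefinable_iff S).1 hXdef
  obtain ⟨n, ψ, hψ⟩ := S.exists_coding [⟨_, θ⟩, ⟨_, S.interFormula θ φ⟩]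
  obtain ⟨k, a, hk, ha⟩ := hμ n ψ δ hδ0
  set X := S.definedBy θ c with hXc
  have h1 : |μ.toFun X - avg a X| ≤ δ := by
    obtain ⟨d, hd⟩ := hψ M ⟨_, θ⟩ (by simp) c
    simpa only [hd] using ha d
  have h2 : ∀ b, |μ.toFun (X ∩ S.definedBy φ b) - avg a (X ∩ S.definedBy φ b)| ≤ δ := by
    intro b
    obtain ⟨d, hd⟩ := hψ M ⟨_, S.interFormula θ φ⟩ (by simp) (Fin.append c b)
    simpa only [hd, S.definedBy_inter] using ha d
  have hXε := hp X hX
  obtain ⟨h1l, h1r⟩ := abs_le.1 h1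
  have havg : ε / 2 ≤ avg a X := by linarith
  have hex : ∃ i, a i ∈ X := by
    by_contra hne
    have : avg a X = 0 := by
      rw [avg, show {i | a i ∈ X} = ∅ from Set.eq_empty_iff_forall_notMem.2 fun i hi =>
        hne ⟨i, hi⟩]
      simp
    linarith
  obtain ⟨k', a', hk', ha'⟩ := exists_avg_restrict a X hex
  have havgpos : 0 < avg a X := by linarith
  have hηavg : η * (ε / 2) ≤ η * avg a X := by gcongr
  refine ⟨k', a', hk', fun b => ?_⟩
  have hYdef := S.isDefinable_definedBy φ b
  obtain ⟨h2l, h2r⟩ := abs_le.1 (h2 b)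
  set Y := S.definedBy φ b with hY
  rw [ha']
  have hmono : avg a (X ∩ Y) ≤ avg a X := by
    unfold avg
    gcongr
    · exact Set.toFinite _
    · exact fun i hi => hi.1
  have hnonneg : 0 ≤ avg a (X ∩ Y) := by
    unfold avg
    positivity
  by_cases hYp : Y ∈ p.sets
  · rw [p.toMeasure_of_mem hYp]
    have h3 := hαle _ (p.inter_mem _ hX _ hYp)
    have h4 : 1 - avg a (X ∩ Y) / avg a X = (avg a X - avg a (X ∩ Y)) / avg a X := by
      field_simp
    rw [h4, abs_of_nonneg (div_nonneg (by linarith) havgpos.le), div_le_iff₀ havgpos]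
    linarith
  · rw [p.toMeasure_of_notMem hYp, zero_sub, abs_neg, abs_of_nonneg (by positivity),
      div_le_iff₀ havgpos]
    have h3 := hαle _ (p.inter_mem _ hX _ ((p.compl_mem_iff _ hYdef).2 hYp))
    have h4 := μ.inter_add_diff hXdef hYdef
    linarith

/-- If an atomless generically stable measure takes no value near some `r ∈ [0, 1]`, then there is
a generically stable type which is not realized. -/
lemma KeislerMeasure.IsGenericallyStable.exists_type_of_gap {μ : KeislerMeasure S M}
    (hμ : μ.IsGenericallyStable) (hμ0 : ∀ c : S.Elem M, μ.toFun {c} = 0) {r ε : ℝ} (hε : 0 < ε)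
    (hr0 : 0 ≤ r) (hr1 : r ≤ 1)
    (h : ∀ Z : Set (S.Elem M), S.IsDefinable Z → ε ≤ |μ.toFun Z - r|) :
    ∃ p : TypeOver S M, p.IsGenericallyStable ∧ ¬ p.IsRealized := by
  obtain ⟨W, hW⟩ := μ.exists_ultrafilter_of_gap hε hr0 hr1 h
  refine ⟨TypeOver.ofUltrafilter W,
    hμ.of_atom (μ.nontrivial_of_atomless hμ0) _ hε fun X hX => hW X hX.1 hX.2, fun hr => ?_⟩
  obtain ⟨c, hc⟩ := (TypeOver.isRealized_iff _).1 hr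
  have := hW _ hc.1 hc.2
  rw [hμ0] at this
  linarith

end Atom

open Classical in
lemma exists_avg_eq_ncard_div {A : Type*} (B : Finset A) :
    ∃ a : Fin B.card → A, ∀ Y, avg a Y = ((B : Set A) ∩ Y).ncard / B.card := by
  refine ⟨fun i => B.equivFin.symm i, fun Y => ?_⟩
  rw [avg]
  congr 2
  have h1 : (B : Set A) ∩ Y =
      (fun i => (B.equivFin.symm i : A)) '' {i | (B.equivFin.symm i : A) ∈ Y} := by
    ext x
    constructor
    · rintro ⟨h1, h2⟩
      exact ⟨B.equivFin ⟨x, h1⟩, by simpa using h2, by simp⟩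
    · rintro ⟨i, hi, rfl⟩
      exact ⟨(B.equivFin.symm i).2, hi⟩
  rw [h1]
  exact (Set.ncard_image_of_injective _
    (Subtype.val_injective.comp B.equivFin.symm.injective)).symm

/-- A failure of uniform cutting gives, by compactness, an ultraproduct of normalized counting
measures which avoids a whole interval of values, hence has an atom; this atom is a
generically stable type, and it is not realized as the sizes of the finite sets are unbounded. -/
theorem IsNIP.cutsFiniteSets_of_typesRealized {T : L.Theory} (hT : IsNIP T) {S : DefSort T}
    (h : GenericallyStableTypesRealized S) : UniformlyCutsFiniteSets S := by
  classical
  intro ε hε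
  by_contra hno
  have H : ∀ (m : ℕ) (χ : L.Formula (Fin S.arity ⊕ Fin m)) (K : ℕ),
      ∃ (M : Type (max u v)) (_ : L.Structure M) (_ : Nonempty M) (_ : M ⊨ T)
        (A : Finset (S.Elem M)), K ≤ A.card ∧ ∃ r : ℝ, 0 ≤ r ∧ r ≤ 1 ∧ ∀ b : Fin m → M,
          ε < |(((A : Set (S.Elem M)) ∩ S.definedBy χ b).ncard : ℝ) / A.card - r| := by
    intro m χ K
    by_contra hK
    push Not at hK
    exact hno ⟨m, χ, K, fun M _ _ _ A hA r h0 h1 => hK M _ _ _ A hA r h0 h1⟩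
  -- the index `(Φ, K)` asks for a failure at all formulas of `Φ`, by a set of size at least `K + 2`
  let I := Finset (Σ m : ℕ, L.Formula (Fin S.arity ⊕ Fin m)) × ℕ
  choose m ψ hψ using fun i : I => S.exists_coding i.1.toList
  choose M i1 i2 i3 A hA r hr0 hr1 hr using fun i : I => H (m i) (ψ i) (i.2 + 2)
  have hApos : ∀ i, 0 < (A i).card := fun i => by
    have := hA i
    omega
  have hnt : ∀ i, Nontrivial (M i) := fun i => by
    obtain ⟨c, -, d, -, hcd⟩ := Finset.one_lt_card.1 (show 1 < (A i).card by
      have := hA i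
      omega)
    exact DefSort.nontrivial_of_ne hcd
  choose a ha using fun i => exists_avg_eq_ncard_div (A i)
  let μ : ∀ i, KeislerMeasure S (M i) := fun i => avgMeasure (hApos i) (a i)
  have hμ : ∀ i X, S.IsDefinable X →
      (μ i).toFun X = ((A i : Set (S.Elem (M i))) ∩ X).ncard / (A i).card := fun i X hX => by
    rw [← ha, ← avgMeasure_apply (hApos i) (a i) hX]
  let U : Ultrafilter I := Ultrafilter.of atTop
  have hU : (U : Filter I) ≤ atTop := Ultrafilter.of_le _
  have hrlim := tendsto_limUnder_of_mem_Icc U fun i => (⟨hr0 i, hr1 i⟩ : r i ∈ Set.Icc (0 : ℝ) 1)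
  have hgap : ∀ Z : Set (S.Elem ((U : Filter I).Product M)), S.IsDefinable Z →
      ε ≤ |(ultraMeasure U μ).toFun Z - limUnder (U : Filter I) r| := by
    intro Z hZ
    obtain ⟨n, φ, b, rfl⟩ := (DefSort.isDefinable_iff S).1 hZ
    obtain ⟨b, rfl⟩ := exists_castTuple U b
    refine ge_of_tendsto ((tendsto_ultraMeasure_definedBy U μ φ b).sub hrlim).abs ?_
    filter_upwards [hU (eventually_ge_atTop ({⟨n, φ⟩}, 0))] with i hi
    obtain ⟨c, hc⟩ := hψ i (M i) ⟨n, φ⟩ (by simpa using hi.1) fun j => b j i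
    dsimp only at hc
    rw [← hc, hμ i _ (S.isDefinable_definedBy _ _)]
    exact (hr i c).le
  have hatomless : ∀ c, (ultraMeasure U μ).toFun {c} = 0 := by
    refine ultraMeasure_atomless U μ fun c => ?_
    have h1 : Tendsto (fun i : I => 1 / ((i.2 : ℝ) + 1)) U (nhds 0) := by
      have h2 : Tendsto (fun i : I => i.2) atTop atTop := by
        rw [← prod_atTop_atTop_eq]
        exact tendsto_snd
      exact (tendsto_one_div_add_atTop_nhds_zero_nat.comp h2).mono_left hU
    refine squeeze_zero (fun i => (μ i).nonneg' _) (fun i => ?_) h1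
    rw [hμ i _ (DefSort.isDefinable_singleton _)]
    have h2 : ((A i : Set (S.Elem (M i))) ∩ {c i}).ncard ≤ 1 :=
      (Set.ncard_le_ncard Set.inter_subset_right).trans (Set.ncard_singleton _).le
    have h3 : (i.2 : ℝ) + 1 ≤ (A i).card := by
      have := hA i
      exact_mod_cast (by omega : i.2 + 1 ≤ (A i).card)
    gcongr
    exact_mod_cast h2
  obtain ⟨p, hp, hpr⟩ := (hT.ultraMeasure_isGenericallyStable U
    fun i => avgMeasure_isGenericallyStable (hApos i) (a i)).exists_type_of_gap hatomless hε
      (ge_of_tendsto hrlim (Eventually.of_forall hr0))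
      (le_of_tendsto hrlim (Eventually.of_forall hr1)) hgap
  exact hpr (h _ p hp)

/-! ### Distal theories -/

namespace DefSort

variable {T : L.Theory} (S : DefSort T)

section Lift

variable {M : Type (max u v)} [L.Structure M] [Nonempty M] [M ⊨ T]

lemma realSort_toElem_eq_iff {n : ℕ} (x y : (realSort T n).Rep M) :
    (realSort T n).toElem x = (realSort T n).toElem y ↔ x.1 = y.1 := by
  rw [toElem_eq_iff]
  constructor
  · intro h
    simp only [realSort, Language.Formula.realize_iInf, Language.Formula.realize_equal,
      Language.Term.realize_var, Sum.elim_inl, Sum.elim_inr] at h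
    exact funext h
  · intro h
    rw [h]
    exact (realSort T n).refl M y.1 y.2

/-- A representative of an element of the sort `S`, as an element of the sort of tuples. -/
noncomputable def liftElem (x : S.Rep M) : (realSort T S.arity).Elem M :=
  (realSort T S.arity).toElem ⟨x.1, Language.Formula.realize_top.2 trivial⟩

lemma liftElem_mem_definedBy_iff {m : ℕ} (φ : L.Formula (Fin S.arity ⊕ Fin m)) (x : S.Rep M)
    (b : Fin m → M) :
    S.liftElem x ∈ (realSort T S.arity).definedBy φ b ↔ φ.Realize (Sum.elim x.1 b) := by
  constructor
  · rintro ⟨y, hy, h⟩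
    have h1 : y.1 = x.1 := (realSort_toElem_eq_iff _ _).1 hy
    exact h1 ▸ h
  · exact fun h => ⟨_, rfl, h⟩

/-- The set of representatives of the elements of `X`, in the sort of tuples. -/
def pull (X : Set (S.Elem M)) : Set ((realSort T S.arity).Elem M) :=
  {t | ∃ x : S.Rep M, S.toElem x ∈ X ∧ S.liftElem x = t}

lemma liftElem_mem_pull_iff (X : Set (S.Elem M)) (x : S.Rep M) :
    S.liftElem x ∈ S.pull X ↔ S.toElem x ∈ X := by
  constructor
  · rintro ⟨y, hy, h⟩
    have h1 : y = x := Subtype.ext ((realSort_toElem_eq_iff _ _).1 h)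
    exact h1 ▸ hy
  · exact fun h => ⟨x, h, rfl⟩

lemma pull_inter (X Y : Set (S.Elem M)) : S.pull (X ∩ Y) = S.pull X ∩ S.pull Y := by
  ext t
  constructor
  · rintro ⟨x, h, rfl⟩
    exact ⟨⟨x, h.1, rfl⟩, x, h.2, rfl⟩
  · rintro ⟨⟨x, h, rfl⟩, h'⟩
    exact ⟨x, ⟨h, (S.liftElem_mem_pull_iff _ _).1 h'⟩, rfl⟩

/-- The set of elements of `S` that have a representative in `Y`. -/
def push (Y : Set ((realSort T S.arity).Elem M)) : Set (S.Elem M) :=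
  {s | ∃ x : S.Rep M, S.toElem x = s ∧ S.liftElem x ∈ Y}

lemma isDefinable_push {Y : Set ((realSort T S.arity).Elem M)}
    (hY : (realSort T S.arity).IsDefinable Y) : S.IsDefinable (S.push Y) := by
  obtain ⟨m, φ, b, rfl⟩ := (isDefinable_iff _).1 hY
  have h : S.push ((realSort T S.arity).definedBy φ b) = S.definedBy φ b := by
    ext s
    exact exists_congr fun x => and_congr_right fun _ => S.liftElem_mem_definedBy_iff φ x b
  rw [h]
  exact S.isDefinable_definedBy φ b

lemma inter_pull_univ_subset (Y : Set ((realSort T S.arity).Elem M)) :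
    Y ∩ S.pull Set.univ ⊆ S.pull (S.push Y) := by
  rintro _ ⟨h, x, -, rfl⟩
  exact ⟨x, ⟨x, rfl, h⟩, rfl⟩

end Lift

/-- A formula defining, in the sort of tuples, the representatives of the elements of the set
defined by `φ` in `S`. -/
noncomputable def pullFormula {m : ℕ} (φ : L.Formula (Fin S.arity ⊕ Fin m)) :
    L.Formula (Fin (realSort T S.arity).arity ⊕ Fin m) :=
  (S.dom.relabel Sum.inl ⊓ S.saturate φ : L.Formula (Fin S.arity ⊕ Fin m))

variable {M : Type (max u v)} [L.Structure M] [Nonempty M] [M ⊨ T]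

lemma definedBy_pullFormula {m : ℕ} (φ : L.Formula (Fin S.arity ⊕ Fin m)) (b : Fin m → M) :
    (realSort T S.arity).definedBy (S.pullFormula φ) b = S.pull (S.definedBy φ b) := by
  have h1 (x : Fin S.arity → M) :
      (S.dom.relabel Sum.inl ⊓ S.saturate φ : L.Formula (Fin S.arity ⊕ Fin m)).Realize
        (Sum.elim x b) ↔ S.dom.Realize x ∧ (S.saturate φ).Realize (Sum.elim x b) := by
    rw [Language.Formula.realize_inf, Language.Formula.realize_relabel, Sum.elim_comp_inl]
  ext t
  constructor
  · rintro ⟨x, rfl, hx⟩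
    obtain ⟨h2, h3⟩ := (h1 x.1).1 hx
    exact ⟨⟨x.1, h2⟩, (S.realize_saturate φ ⟨x.1, h2⟩ b).1 h3, rfl⟩
  · rintro ⟨x, hx, rfl⟩
    exact ⟨_, rfl, (h1 x.1).2 ⟨x.2, (S.realize_saturate φ x b).2 hx⟩⟩

lemma isDefinable_pull {X : Set (S.Elem M)} (hX : S.IsDefinable X) :
    (realSort T S.arity).IsDefinable (S.pull X) := by
  obtain ⟨m, φ, b, rfl⟩ := (isDefinable_iff _).1 hX
  rw [← definedBy_pullFormula]
  exact isDefinable_definedBy _ _ _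

end DefSort

section Cells

variable {T : L.Theory} {S : DefSort T} {M : Type (max u v)} [L.Structure M] [Nonempty M] [M ⊨ T]

/-- The atom of the Boolean algebra generated by `j` that lies in exactly the members of `s`. -/
def cell {A : Type*} (j s : Finset (Set A)) : Set A := {t | ∀ X ∈ j, t ∈ X ↔ X ∈ s}

lemma isDefinable_cell {j s : Finset (Set (S.Elem M))} (hj : ∀ X ∈ j, S.IsDefinable X) :
    S.IsDefinable (cell j s) := by
  classical
  induction j using Finset.induction_on with
  | empty =>
    convert DefSort.isDefinable_univ (S := S) (M := M) using 1
    ext t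
    simp [cell]
  | insert X j _ ih =>
    have h1 : cell (insert X j) s = (if X ∈ s then X else Xᶜ) ∩ cell j s := by
      ext t
      by_cases h : X ∈ s <;> simp [cell, h]
    rw [h1]
    have h2 := hj X (Finset.mem_insert_self _ _)
    refine DefSort.IsDefinable.inter ?_ (ih fun Y hY => hj Y (Finset.mem_insert_of_mem hY))
    split_ifs
    exacts [h2, h2.compl]

lemma KeislerMeasure.sum_cell (μ : KeislerMeasure S M) {j : Finset (Set (S.Elem M))}
    (hj : ∀ X ∈ j, S.IsDefinable X) {Z : Set (S.Elem M)} (hZ : S.IsDefinable Z) :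
    ∑ s ∈ j.powerset, μ.toFun (Z ∩ cell j s) = μ.toFun Z := by
  classical
  induction j using Finset.induction_on generalizing Z with
  | empty => simp [cell]
  | insert X j hX ih =>
    have hXdef := hj X (Finset.mem_insert_self _ _)
    have hj' : ∀ Y ∈ j, S.IsDefinable Y := fun Y hY => hj Y (Finset.mem_insert_of_mem hY)
    rw [Finset.sum_powerset_insert hX]
    have h1 : ∀ s ∈ j.powerset, μ.toFun (Z ∩ cell (insert X j) s) =
        μ.toFun ((Z ∩ Xᶜ) ∩ cell j s) := by
      intro s hs
      have : X ∉ s := fun h => hX (Finset.mem_powerset.1 hs h)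
      congr 1
      ext t
      simp [cell, this, and_assoc]
    have h2 : ∀ s ∈ j.powerset, μ.toFun (Z ∩ cell (insert X j) (insert X s)) =
        μ.toFun ((Z ∩ X) ∩ cell j s) := by
      intro s hs
      congr 1
      ext t
      simp only [cell, Finset.mem_insert, Set.mem_inter_iff, Set.mem_ofPred_eq, forall_eq_or_imp,
        true_or, iff_true, and_assoc]
      refine and_congr_right fun _ => and_congr_right fun _ => forall₂_congr fun Y hY => ?_
      have : Y ≠ X := fun h => hX (h ▸ hY)
      simp [this]
    rw [Finset.sum_congr rfl h1, Finset.sum_congr rfl h2, ih hj' (hZ.inter hXdef.compl),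
      ih hj' (hZ.inter hXdef), add_comm, μ.inter_add_diff hZ hXdef]

end Cells

/-- The diagonal embedding of a structure in an ultrapower. -/
def diagonalEmbedding {J N : Type (max u v)} [L.Structure N] [Nonempty N] (U : Ultrafilter J) :
    N ↪ₑ[L] (U : Filter J).Product fun _ => N where
  toFun x := ((fun _ => x : J → N) : (U : Filter J).Product fun _ => N)
  map_formula' _ φ x :=
    (castTuple_realize U φ fun j _ => x j).trans eventually_const

section Fibre

variable {T : L.Theory} {S : DefSort T} {N : Type (max u v)} [L.Structure N] [Nonempty N] [N ⊨ T]

/-- Let `ν` be a measure on tuples whose image on `S` is `{0, 1}`-valued. On finitely many definable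
sets, `ν` agrees with a measure supported by the representatives of a single element of `S`: all
atoms of positive measure have full image in `S`, so these images have an element in common. -/
lemma exists_fibre_measure (ν : KeislerMeasure (realSort T S.arity) N)
    (h01 : ∀ X : Set (S.Elem N), S.IsDefinable X →
      ν.toFun (S.pull X) = 0 ∨ ν.toFun (S.pull X) = 1)
    (huniv : ν.toFun (S.pull Set.univ) = 1)
    (j : Finset {X : Set ((realSort T S.arity).Elem N) // (realSort T S.arity).IsDefinable X}) :
    ∃ (x : S.Rep N) (ν' : KeislerMeasure (realSort T S.arity) N),
      ν'.toFun (S.pull {S.toElem x}) = 1 ∧ ∀ X ∈ j, ν'.toFun X.1 = ν.toFun X.1 := by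
  classical
  set k : Finset (Set ((realSort T S.arity).Elem N)) := j.image Subtype.val with hk
  have hkdef : ∀ X ∈ k, (realSort T S.arity).IsDefinable X := by
    intro X hX
    obtain ⟨Y, -, rfl⟩ := Finset.mem_image.1 hX
    exact Y.2
  have hpu := S.isDefinable_pull (DefSort.isDefinable_univ (S := S) (M := N))
  have hinter : ∀ Y, (realSort T S.arity).IsDefinable Y →
      ν.toFun (Y ∩ S.pull Set.univ) = ν.toFun Y := by
    intro Y hY
    have h1 := ν.inter_add_diff hY hpu
    have h2 := ν.mono (hY.inter hpu.compl) hpu.compl Set.inter_subset_right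
    rw [ν.compl hpu, huniv, sub_self] at h2
    linarith [ν.nonneg' (Y ∩ (S.pull Set.univ)ᶜ)]
  have hfull : ∀ s : Finset (Set ((realSort T S.arity).Elem N)), 0 < ν.toFun (cell k s) →
      ν.toFun (S.pull (S.push (cell k s))) = 1 := by
    intro s hs
    have hdef := isDefinable_cell (s := s) hkdef
    refine (h01 _ (S.isDefinable_push hdef)).resolve_left fun h0 => ?_
    have h1 := ν.mono (hdef.inter hpu) (S.isDefinable_pull (S.isDefinable_push hdef))
      (S.inter_pull_univ_subset _)
    rw [hinter _ hdef, h0] at h1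
    linarith
  have hfin : ∀ P : Finset (Finset (Set ((realSort T S.arity).Elem N))),
      (∀ s ∈ P, 0 < ν.toFun (cell k s)) →
      S.IsDefinable {c : S.Elem N | ∀ s ∈ P, c ∈ S.push (cell k s)} ∧
        ν.toFun (S.pull {c : S.Elem N | ∀ s ∈ P, c ∈ S.push (cell k s)}) = 1 := by
    intro P
    induction P using Finset.induction_on with
    | empty =>
      intro _
      have h1 : {c : S.Elem N | ∀ s ∈ (∅ : Finset (Finset (Set ((realSort T S.arity).Elem N)))),
          c ∈ S.push (cell k s)} = Set.univ := by
        ext c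
        simp
      rw [h1]
      exact ⟨DefSort.isDefinable_univ, huniv⟩
    | insert s P _ ih =>
      intro hP
      obtain ⟨h1, h2⟩ := ih fun s' hs' => hP s' (Finset.mem_insert_of_mem hs')
      have h3 := hfull s (hP s (Finset.mem_insert_self _ _))
      have h4 := S.isDefinable_push (isDefinable_cell (s := s) hkdef)
      have h5 : {c : S.Elem N | ∀ s' ∈ insert s P, c ∈ S.push (cell k s')} =
          S.push (cell k s) ∩ {c : S.Elem N | ∀ s ∈ P, c ∈ S.push (cell k s)} := by
        ext c
        simp
      rw [h5, DefSort.pull_inter]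
      refine ⟨h4.inter h1, ?_⟩
      have h6 := ν.inter_add_diff (S.isDefinable_pull h4) (S.isDefinable_pull h1)
      have h7 := ν.mono ((S.isDefinable_pull h4).inter (S.isDefinable_pull h1).compl)
        (S.isDefinable_pull h1).compl Set.inter_subset_right
      rw [ν.compl (S.isDefinable_pull h1), h2, sub_self] at h7
      linarith [ν.nonneg' (S.pull (S.push (cell k s)) ∩
        (S.pull {c : S.Elem N | ∀ s ∈ P, c ∈ S.push (cell k s)})ᶜ)]
  obtain ⟨-, hP⟩ := hfin {s ∈ k.powerset | 0 < ν.toFun (cell k s)}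
    fun s hs => (Finset.mem_filter.1 hs).2
  obtain ⟨c, hc⟩ : {c : S.Elem N | ∀ s ∈ ({s ∈ k.powerset | 0 < ν.toFun (cell k s)} :
      Finset (Finset (Set ((realSort T S.arity).Elem N)))), c ∈ S.push (cell k s)}.Nonempty := by
    by_contra hempty
    rw [Set.not_nonempty_iff_eq_empty] at hempty
    have h1 : S.pull (∅ : Set (S.Elem N)) = ∅ := by
      ext t
      simp [DefSort.pull]
    rw [hempty, h1, ν.empty] at hP
    exact zero_ne_one hP
  obtain ⟨x, rfl⟩ := S.exists_toElem c
  -- atoms of measure zero get the weight zero, so the choice of a point does not matter for them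
  have he : ∀ s : k.powerset, ∃ y : S.Rep N, S.toElem y = S.toElem x ∧
      (0 < ν.toFun (cell k s.1) → S.liftElem y ∈ cell k s.1) := by
    intro s
    by_cases hs : 0 < ν.toFun (cell k s.1)
    · obtain ⟨y, hy, hy'⟩ := hc s.1 (Finset.mem_filter.2 ⟨s.2, hs⟩)
      exact ⟨y, hy, fun _ => hy'⟩
    · exact ⟨x, rfl, fun h => absurd h hs⟩
  choose e he1 he2 using he
  have hsum : ∑ s : k.powerset, ν.toFun (cell k s.1) = 1 := by
    rw [Finset.sum_coe_sort k.powerset fun s => ν.toFun (cell k s), ← ν.univ,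
      ← ν.sum_cell hkdef DefSort.isDefinable_univ]
    simp
  refine ⟨x, weightedMeasure (fun s => S.liftElem (e s))
    (fun s : k.powerset => ν.toFun (cell k s.1))
    (fun s => ν.nonneg' _) hsum, ?_, fun X hX => ?_⟩
  · rw [weightedMeasure_apply _ _ _ _ (S.isDefinable_pull (DefSort.isDefinable_singleton _)),
      ← hsum]
    refine Finset.sum_congr rfl fun s _ => ?_
    rw [if_pos]
    rw [DefSort.liftElem_mem_pull_iff]
    exact he1 s
  · rw [weightedMeasure_apply _ _ _ _ X.2, ← ν.sum_cell hkdef X.2,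
      ← Finset.sum_coe_sort k.powerset]
    refine Finset.sum_congr rfl fun s _ => ?_
    have hXk : X.1 ∈ k := Finset.mem_image_of_mem _ hX
    have h1 : ν.toFun (X.1 ∩ cell k s.1) = if X.1 ∈ s.1 then ν.toFun (cell k s.1) else 0 := by
      split_ifs with h
      · congr 1
        exact Set.inter_eq_right.2 fun t ht => (ht X.1 hXk).2 h
      · rw [← ν.empty]
        congr 1
        exact Set.eq_empty_iff_forall_notMem.2 fun t ht => h ((ht.2 X.1 hXk).1 ht.1)
    rw [h1]
    rcases (ν.nonneg' (cell k s.1)).eq_or_lt with h0 | hpos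
    · rw [← h0]
      simp
    · have h2 := he2 s hpos X.1 hXk
      simp only [h2]

/-- A measure on tuples whose image on `S` is an atomless `{0, 1}`-valued measure is not smooth. In
an ultrapower of the model it has the extension by ultralimits, whose image on `S` is again
atomless, and an extension whose image on `S` is concentrated on a point. -/
lemma not_isSmooth_of_image_atomless (ν : KeislerMeasure (realSort T S.arity) N)
    (h01 : ∀ X : Set (S.Elem N), S.IsDefinable X →
      ν.toFun (S.pull X) = 0 ∨ ν.toFun (S.pull X) = 1)
    (huniv : ν.toFun (S.pull Set.univ) = 1)
    (h0 : ∀ c : S.Elem N, ν.toFun (S.pull {c}) = 0) : ¬ ν.IsSmooth := by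
  classical
  intro hsmooth
  let J := Finset {X : Set ((realSort T S.arity).Elem N) // (realSort T S.arity).IsDefinable X}
  choose x ν' hx hν' using fun j : J => exists_fibre_measure ν h01 huniv j
  let U : Ultrafilter J := Ultrafilter.of atTop
  have hU : (U : Filter J) ≤ atTop := Ultrafilter.of_le _
  have hext1 : (ultraMeasure U fun _ => ν).Extends (diagonalEmbedding U) ν := by
    intro m φ b
    exact tendsto_nhds_unique (tendsto_ultraMeasure_definedBy U (fun _ => ν) φ fun j _ => b j)
      tendsto_const_nhds
  have hext2 : (ultraMeasure U ν').Extends (diagonalEmbedding U) ν := by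
    intro m φ b
    refine tendsto_nhds_unique (tendsto_ultraMeasure_definedBy U ν' φ fun j _ => b j) ?_
    refine tendsto_const_nhds.congr' ?_
    filter_upwards [hU (eventually_ge_atTop
      {⟨(realSort T S.arity).definedBy φ b, DefSort.isDefinable_definedBy _ _ _⟩})] with j hj
    exact (hν' j _ (Finset.singleton_subset_iff.1 hj)).symm
  have heq := (hsmooth _ (diagonalEmbedding U)).unique hext1 hext2
  have hpull : ∀ j, (realSort T S.arity).definedBy (S.pullFormula S.rel) (fun l => (x j).1 l) =
      S.pull {S.toElem (x j)} := fun j => by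
    rw [DefSort.definedBy_pullFormula]
    congr 1
    exact S.definedBy_rel (x j)
  have h1 := tendsto_ultraMeasure_definedBy U (fun _ => ν) (S.pullFormula S.rel)
    fun l j => (x j).1 l
  have h2 := tendsto_ultraMeasure_definedBy U ν' (S.pullFormula S.rel) fun l j => (x j).1 l
  simp only [hpull, h0] at h1
  simp only [hpull, hx] at h2
  rw [heq] at h1
  have h3 := tendsto_nhds_unique h1 tendsto_const_nhds
  have h4 := tendsto_nhds_unique h2 tendsto_const_nhds
  exact zero_ne_one (h3.symm.trans h4)

end Fibre

/-- A generically stable type on `S` lifts, in an ultrapower of the model, to a generically stable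
measure on tuples: finite sequences approximating the type are lifted to representatives, and in a
NIP theory the ultraproduct of their frequency measures is generically stable. -/
lemma IsNIP.exists_lift {T : L.Theory} (hT : IsNIP T) {S : DefSort T} {M : Type (max u v)}
    [L.Structure M] [Nonempty M] [M ⊨ T] (p : TypeOver S M) (hp : p.IsGenericallyStable)
    (hpr : ¬ p.IsRealized) :
    ∃ (N : Type (max u v)) (_ : L.Structure N) (_ : Nonempty N) (_ : N ⊨ T)
      (ν : KeislerMeasure (realSort T S.arity) N), ν.IsGenericallyStable ∧
      (∀ X : Set (S.Elem N), S.IsDefinable X →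
        ν.toFun (S.pull X) = 0 ∨ ν.toFun (S.pull X) = 1) ∧
      ν.toFun (S.pull Set.univ) = 1 ∧ ∀ c : S.Elem N, ν.toFun (S.pull {c}) = 0 := by
  classical
  have hnt := p.toMeasure.nontrivial_of_atomless (p.atomless_of_not_isRealized hpr)
  -- at the index `(Φ, n)`, the type is approximated on all formulas of `Φ` up to `1 / (n + 1)`
  let I := Finset (Σ m : ℕ, L.Formula (Fin S.arity ⊕ Fin m)) × ℕ
  choose m ψ hψ using fun i : I => S.exists_coding i.1.toList
  choose k a hk ha using fun i : I => hp (m i) (ψ i) (1 / (i.2 + 1)) (by positivity)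
  choose r hr using fun s : S.Elem M => S.exists_toElem s
  let μ : I → KeislerMeasure (realSort T S.arity) M :=
    fun i => avgMeasure (hk i) fun j => S.liftElem (r (a i j))
  have hμ : ∀ i X, S.IsDefinable X → (μ i).toFun (S.pull X) = avg (a i) X := by
    intro i X hX
    rw [avgMeasure_apply _ _ (S.isDefinable_pull hX)]
    unfold avg
    simp only [DefSort.liftElem_mem_pull_iff, hr]
  let U : Ultrafilter I := Ultrafilter.of atTop
  have hU : (U : Filter I) ≤ atTop := Ultrafilter.of_le _
  have h1 : Tendsto (fun i : I => 1 / ((i.2 : ℝ) + 1)) U (nhds 0) := by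
    have h2 : Tendsto (fun i : I => i.2) atTop atTop := by
      rw [← prod_atTop_atTop_eq]
      exact tendsto_snd
    exact (tendsto_one_div_add_atTop_nhds_zero_nat.comp h2).mono_left hU
  have hlim : ∀ {n : ℕ} (φ : L.Formula (Fin S.arity ⊕ Fin n)) (b : Fin n → I → M),
      Tendsto (fun i => p.toMeasure.toFun (S.definedBy φ fun l => b l i)) U
        (nhds ((ultraMeasure U μ).toFun (S.pull (S.definedBy φ (castTuple U b))))) := by
    intro n φ b
    rw [← DefSort.definedBy_pullFormula]
    have h2 := tendsto_ultraMeasure_definedBy U μ (S.pullFormula φ) b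
    have h3 : Tendsto (fun i => p.toMeasure.toFun (S.definedBy φ fun l => b l i) -
        (μ i).toFun (S.pull (S.definedBy φ fun l => b l i))) U (nhds 0) := by
      refine squeeze_zero_norm' ?_ h1
      filter_upwards [hU (eventually_ge_atTop ({⟨n, φ⟩}, 0))] with i hi
      obtain ⟨c, hc⟩ := hψ i M ⟨n, φ⟩ (by simpa using hi.1) fun j => b j i
      dsimp only at hc
      rw [hμ i _ (S.isDefinable_definedBy _ _), ← hc]
      exact ha i c
    simp only [DefSort.definedBy_pullFormula] at h2 ⊢
    simpa using h3.add h2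
  refine ⟨(U : Filter I).Product fun _ => M, inferInstance, inferInstance, inferInstance,
    ultraMeasure U μ, hT.ultraMeasure_isGenericallyStable U
      fun i => avgMeasure_isGenericallyStable _ _, fun X hX => ?_, ?_, fun c => ?_⟩
  · obtain ⟨n, φ, b, rfl⟩ := (DefSort.isDefinable_iff S).1 hX
    obtain ⟨b, rfl⟩ := exists_castTuple U b
    have h2 : IsClosed ({0, 1} : Set ℝ) := (Set.toFinite _).isClosed
    exact h2.mem_of_tendsto (hlim φ b)
      (Eventually.of_forall fun i => p.toMeasure_eq_zero_or_one _)
  · have h2 := hlim (⊤ : L.Formula (Fin S.arity ⊕ Fin 0)) Fin.elim0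
    simp only [DefSort.definedBy_top, KeislerMeasure.univ] at h2
    exact tendsto_nhds_unique h2 tendsto_const_nhds
  · obtain ⟨x, rfl⟩ := S.exists_toElem c
    obtain ⟨b, hb⟩ := exists_castTuple U x.1
    rw [← S.definedBy_rel x, ← hb]
    refine tendsto_nhds_unique (hlim S.rel b) (tendsto_const_nhds.congr' ?_)
    have hdom : ∀ᶠ i in U, S.dom.Realize fun j => b j i := by
      rw [← castTuple_realize, hb]
      exact x.2
    filter_upwards [hdom] with i hi
    rw [S.definedBy_rel ⟨_, hi⟩, p.atomless_of_not_isRealized hpr]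

theorem IsDistal.typesRealized {T : L.Theory} (hT : IsDistal T) (S : DefSort T) :
    GenericallyStableTypesRealized S := by
  intro M _ _ _ p hp
  by_contra hpr
  obtain ⟨N, _, _, _, ν, hν, h01, huniv, h0⟩ := hT.1.exists_lift p hp hpr
  exact not_isSmooth_of_image_atomless ν h01 huniv h0 (hT.2 _ N ν hν)

end ModelTheoryNIP

theorem mainTheorem3 {L : FirstOrder.Language.{u, v}} (T : L.Theory)
    (hT : ModelTheoryNIP.IsNIP T) (S : ModelTheoryNIP.DefSort T) :
    [ModelTheoryNIP.UniformlyCutsFiniteSets S,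
      ModelTheoryNIP.UniformlyCutsGenericallyStableMeasures S,
      ModelTheoryNIP.GenericallyStableTypesRealized S].TFAE ∧
    (ModelTheoryNIP.IsDistal T → ModelTheoryNIP.UniformlyCutsFiniteSets S) := by
  refine ⟨?_, fun h => hT.cutsFiniteSets_of_typesRealized (h.typesRealized S)⟩
  tfae_have 1 → 2 := hT.cutsMeasures_of_cutsFiniteSets
  tfae_have 2 → 3 := ModelTheoryNIP.typesRealized_of_cutsMeasures
  tfae_have 3 → 1 := hT.cutsFiniteSets_of_typesRealized
  tfae_finish
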